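/- Let $k\ge 0$ be an integer and let $\alpha,\beta:[0,\infty)\to\mathbb R$ be unbounded, continuous, nondecreasing functions such that $\beta$ is convex and, for some $\varkappa>0$, the function $\alpha(s)/s^{\varkappa}$ is nondecreasing for all sufficiently large $s$. Let $|\cdot|$ denote the maximum norm on $\mathbb R^k$ and $\mathbb C^k$. A cone in $\mathbb R^k$ is a set stable under multiplication by positive numbers. A conic neighborhood of a cone $U$ is a cone $W\supset U$ with open projection, i.e. such that $W\setminus\{0\}$ is open. For a nonempty cone $W$ and $A,B>0$ put $$\rho_{W,A,B}(x+iy)=-\alpha(|x|/A)+\beta(B|y|)+\beta(B\,\delta_W(x)),\qquad \delta_W(x)=\inf_{x'\in W}|x-x'|,\quad x,y\in\mathbb R^k.$$ Let $\mathcal E^{\beta,B}_{\alpha,A}(W)$ and $H^{\beta,B}_{\alpha,A}(W)$ be the spaces of entire functions $f$ on $\mathbb C^k$ with, respectively, finite norm $$\sup_{z\in\mathbb C^k}|f(z)|e^{-\rho_{W,A,B}(z)},\qquad \Big(\int_{\mathbb C^k}|f(z)|^2e^{-2\rho_{W,A,B}(z)}\,d\lambda(z)\Big)^{1/2},$$ where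 $\lambda$ is Lebesgue measure. For a nonempty cone $U$ let $$\mathcal E^\beta_\alpha(U)=\bigcup_{A,B>0,\;W\supset U}\mathcal E^{\beta,B}_{\alpha,A}(W),$$ where $W$ ranges over all conic neighborhoods of $U$, with the (locally convex) inductive limit topology. (1) For every nonempty cone $U$, the space $\mathcal E^\beta_\alpha(U)$ coincides, both as a set and topologically, with $\bigcup_{A,B>0,\;W\supset U}H^{\beta,B}_{\alpha,A}(W)$ endowed with the inductive limit topology. (2) Suppose that the system of conic neighborhoods of $U$ is countably generated in the following sense: there is a sequence $(W_n)$ of conic neighborhoods of $U$ such that the closure of every conic neighborhood of $U$ contains some $W_n$. Then $\mathcal E^\beta_\alpha(U)$ is a nuclear DFS space, i.e. it is nuclear and it is the inductive limit of a sequence of locally convex spaces with injective compact linking maps. (3) Every nonempty cone that is closed or has open projection satisfies the condition in (2). -/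

import Mathlib

open Set Filter Topology MeasureTheory

noncomputable section

namespace ConeSpaces

/-! ### Locally convex inductive limits, nuclear spaces, DFS spaces -/

/-- The inductive limit topology on a complex vector space `E` defined by linear maps `φ i : X i → E`
from topological vector spaces: the finest locally convex vector space topology on `E` for which all
the `φ i` are continuous. -/
abbrev inductiveLimitTopology {ι : Type*} (X : ι → Type*) [∀ i, AddCommGroup (X i)]
    [∀ i, Module ℂ (X i)] [∀ i, TopologicalSpace (X i)]
    {E : Type*} [AddCommGroup E] [Module ℂ E] (φ : ∀ i, X i →ₗ[ℂ] E) : TopologicalSpace E :=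
  sInf {t : TopologicalSpace E |
    @IsTopologicalAddGroup E t _ ∧ @ContinuousSMul ℂ E _ _ t ∧
    @LocallyConvexSpace ℝ E _ _ _ _ t ∧ ∀ i, @Continuous (X i) E _ t (φ i)}

/-- A continuous linear map `u` from a topological vector space `E` to a Banach space `F` is nuclear
if `u x = ∑ i, c i • (f i x • y i)` with `c` absolutely summable, `f` an equicontinuous sequence in
the dual of `E`, and `y` a bounded sequence in `F`. -/
def IsNuclearMap {E F : Type*} [AddCommGroup E] [Module ℂ E] [TopologicalSpace E]
    [NormedAddCommGroup F] [NormedSpace ℂ F] (u : E →L[ℂ] F) : Prop :=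
  ∃ (c : ℕ → ℂ) (f : ℕ → E →L[ℂ] ℂ) (y : ℕ → F),
    Summable (fun i => ‖c i‖) ∧
    Equicontinuous (fun i => (f i : E → ℂ)) ∧
    Bornology.IsBounded (Set.range y) ∧
    ∀ x : E, HasSum (fun i => c i • (f i x • y i)) (u x)

/-- A nuclear space: a Hausdorff locally convex space each of whose continuous linear maps into a
Banach space is nuclear. -/
structure IsNuclearSpace (E : Type) [AddCommGroup E] [Module ℂ E] [TopologicalSpace E] : Prop where
  isTopologicalAddGroup : IsTopologicalAddGroup E
  continuousSMul : ContinuousSMul ℂ E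
  locallyConvex : LocallyConvexSpace ℝ E
  t2 : T2Space E
  nuclear : ∀ (F : Type) [NormedAddCommGroup F] [NormedSpace ℂ F] [CompleteSpace F]
    (u : E →L[ℂ] F), IsNuclearMap u

/-- A DFS space: the inductive limit of a sequence of (Hausdorff) locally convex spaces with
injective compact linking maps `u n : X n → X (n + 1)`. The canonical maps to the limit are `φ n`. -/
def IsDFSSpace (E : Type) [AddCommGroup E] [Module ℂ E] [TopologicalSpace E] : Prop :=
  ∃ (X : ℕ → Type) (_ : ∀ n, AddCommGroup (X n)) (_ : ∀ n, Module ℂ (X n))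
    (_ : ∀ n, TopologicalSpace (X n)) (u : ∀ n, X n →L[ℂ] X (n + 1)) (φ : ∀ n, X n →ₗ[ℂ] E),
    (∀ n, IsTopologicalAddGroup (X n)) ∧ (∀ n, ContinuousSMul ℂ (X n)) ∧
    (∀ n, LocallyConvexSpace ℝ (X n)) ∧ (∀ n, T2Space (X n)) ∧
    (∀ n, Function.Injective (u n)) ∧ (∀ n, IsCompactOperator (u n)) ∧
    (∀ n x, φ (n + 1) (u n x) = φ n x) ∧ (∀ n, Function.Injective (φ n)) ∧
    (∀ e : E, ∃ n x, φ n x = e) ∧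
    (inferInstance : TopologicalSpace E) = inductiveLimitTopology X φ

/-! ### Weights and cones -/

/-- A pair of unbounded continuous increasing functions on `[0, ∞)` (their values at negative
arguments play no role) such that `β` is convex and `α(s) / s ^ κ` is nondecreasing for large `s`,
for some `κ > 0`. -/
structure WeightPair where
  α : ℝ → ℝ
  β : ℝ → ℝ
  α_cont : ContinuousOn α (Ici 0)
  β_cont : ContinuousOn β (Ici 0)
  α_mono : MonotoneOn α (Ici 0)
  β_mono : MonotoneOn β (Ici 0)
  α_unbounded : ¬ BddAbove (α '' Ici 0)
  β_unbounded : ¬ BddAbove (β '' Ici 0)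
  β_convex : ConvexOn ℝ (Ici 0) β
  α_growth : ∃ κ : ℝ, 0 < κ ∧ ∃ s₀ : ℝ, 0 < s₀ ∧ MonotoneOn (fun s => α s / s ^ κ) (Ici s₀)

/-- `W` is a cone in `ℝᵏ`: stable under multiplication by positive numbers. -/
def IsCone {k : ℕ} (W : Set (Fin k → ℝ)) : Prop :=
  ∀ x ∈ W, ∀ t : ℝ, 0 < t → t • x ∈ W

/-- The projection of the cone `W` to the sphere `(ℝᵏ ∖ {0}) / ℝ₊` is open. By definition of the
quotient topology this means that `W ∖ {0}` is open. -/
def HasOpenProjection {k : ℕ} (W : Set (Fin k → ℝ)) : Prop :=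
  IsOpen (W \ {0})

/-- `W` is a conic neighborhood of `U`. -/
structure IsConicNhd {k : ℕ} (W U : Set (Fin k → ℝ)) : Prop where
  isCone : IsCone W
  isOpen : HasOpenProjection W
  subset : U ⊆ W

/-- Nonempty cones in `ℝᵏ`. -/
structure NonemptyCone (k : ℕ) where
  carrier : Set (Fin k → ℝ)
  isCone : IsCone carrier
  nonempty : carrier.Nonempty

/-- The conic neighborhoods of `U` are countably generated up to closure: there is a sequence of
conic neighborhoods of `U` such that the closure of every conic neighborhood of `U` contains a
member of the sequence. -/
def NonemptyCone.CountablyGenerated {k : ℕ} (U : NonemptyCone k) : Prop :=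
  ∃ W : ℕ → Set (Fin k → ℝ), (∀ n, IsConicNhd (W n) U.carrier) ∧
    ∀ V, IsConicNhd V U.carrier → ∃ n, W n ⊆ closure V

/-- `ρ_{W,A,B}(x + iy) = -α(|x/A|) + β(B|y|) + β(B δ_W(x))`. All norms are maximum norms. -/
def rho {k : ℕ} (w : WeightPair) (W : Set (Fin k → ℝ)) (A B : ℝ) (z : Fin k → ℂ) : ℝ :=
  -w.α (‖fun j => (z j).re‖ / A) + w.β (B * ‖fun j => (z j).im‖)
    + w.β (B * Metric.infDist (fun j => (z j).re) W)

/-! ### The spaces with supremum norms -/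

/-- The entire functions `f` on `ℂᵏ` for which `sup |f(z)| exp(-ρ_{W,A,B}(z))` is finite. -/
def supSubmodule {k : ℕ} (w : WeightPair) (W : Set (Fin k → ℝ)) (A B : ℝ) :
    Submodule ℂ ((Fin k → ℂ) → ℂ) where
  carrier := {f | Differentiable ℂ f ∧
    BddAbove (range fun z => ‖f z‖ * Real.exp (-rho w W A B z))}
  zero_mem' := by
    refine ⟨differentiable_const 0, 0, ?_⟩
    rintro _ ⟨z, rfl⟩
    simp
  add_mem' := by
    rintro f g ⟨hf, a, ha⟩ ⟨hg, b, hb⟩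
    refine ⟨hf.add hg, a + b, ?_⟩
    rintro _ ⟨z, rfl⟩
    have h1 := ha ⟨z, rfl⟩
    have h2 := hb ⟨z, rfl⟩
    have h3 : ‖f z + g z‖ * Real.exp (-rho w W A B z)
        ≤ (‖f z‖ + ‖g z‖) * Real.exp (-rho w W A B z) := by
      gcongr; exact norm_add_le _ _
    simp only [Pi.add_apply] at *
    linarith
  smul_mem' := by
    rintro c f ⟨hf, a, ha⟩
    refine ⟨hf.const_smul c, ‖c‖ * a, ?_⟩
    rintro _ ⟨z, rfl⟩
    have h1 := ha ⟨z, rfl⟩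
    simp only [Pi.smul_apply, norm_smul, mul_assoc] at *
    gcongr

/-- The normed space `𝓔^{β,B}_{α,A}(W)`. -/
def SupStep {k : ℕ} (w : WeightPair) (W : Set (Fin k → ℝ)) (A B : ℝ) : Type :=
  ↥(supSubmodule w W A B)

namespace SupStep

variable {k : ℕ} (w : WeightPair) (W : Set (Fin k → ℝ)) (A B : ℝ)

instance : AddCommGroup (SupStep w W A B) := inferInstanceAs (AddCommGroup ↥(supSubmodule w W A B))

instance : Module ℂ (SupStep w W A B) := inferInstanceAs (Module ℂ ↥(supSubmodule w W A B))

/-- The norm `‖f‖_{W,A,B} = sup |f(z)| exp(-ρ_{W,A,B}(z))`. -/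
def supNorm : AddGroupNorm (SupStep w W A B) where
  toFun f := ⨆ z, ‖f.1 z‖ * Real.exp (-rho w W A B z)
  map_zero' := by
    have h : ∀ z, ((0 : SupStep w W A B).1 z) = 0 := fun _ => rfl
    simp [h]
  add_le' f g := by
    refine ciSup_le fun z => ?_
    have h1 := le_ciSup f.2.2 z
    have h2 := le_ciSup g.2.2 z
    have h3 : ‖f.1 z + g.1 z‖ * Real.exp (-rho w W A B z)
        ≤ (‖f.1 z‖ + ‖g.1 z‖) * Real.exp (-rho w W A B z) := by
      gcongr; exact norm_add_le _ _
    have h4 : (f + g).1 z = f.1 z + g.1 z := rfl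
    rw [h4]
    linarith
  neg' f := by
    have h : ∀ z, (-f).1 z = -(f.1 z) := fun _ => rfl
    simp [h]
  eq_zero_of_map_eq_zero' f hf := by
    refine Subtype.ext (funext fun z => ?_)
    have h1 : ‖f.1 z‖ * Real.exp (-rho w W A B z) ≤ 0 :=
      (le_ciSup f.2.2 z).trans hf.le
    have h2 : ‖f.1 z‖ ≤ 0 := by
      by_contra! h
      have := mul_pos h (Real.exp_pos (-rho w W A B z))
      linarith
    exact norm_le_zero_iff.1 h2

instance : NormedAddCommGroup (SupStep w W A B) := (supNorm w W A B).toNormedAddCommGroup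

theorem norm_def (f : SupStep w W A B) :
    ‖f‖ = ⨆ z, ‖f.1 z‖ * Real.exp (-rho w W A B z) := rfl

instance : NormedSpace ℂ (SupStep w W A B) where
  norm_smul_le c f := by
    have h : ∀ z, (c • f).1 z = c * f.1 z := fun _ => rfl
    rw [norm_def, norm_def, Real.mul_iSup_of_nonneg (norm_nonneg c)]
    simp [h, mul_assoc]

end SupStep

/-! ### The spaces with Hilbert norms -/

/-- The entire functions `f` on `ℂᵏ` for which `f exp(-ρ_{W,A,B})` is square-integrable with respect
to Lebesgue measure. -/
def hilbertSubmodule {k : ℕ} (w : WeightPair) (W : Set (Fin k → ℝ)) (A B : ℝ) :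
    Submodule ℂ ((Fin k → ℂ) → ℂ) where
  carrier := {f | Differentiable ℂ f ∧
    MemLp (fun z => f z * (Real.exp (-rho w W A B z) : ℂ)) 2 volume}
  zero_mem' := by
    refine ⟨differentiable_const 0, ?_⟩
    simp
  add_mem' := by
    rintro f g ⟨hf, hf'⟩ ⟨hg, hg'⟩
    refine ⟨hf.add hg, ?_⟩
    convert hf'.add hg' using 2 with z
    simp [add_mul]
  smul_mem' := by
    rintro c f ⟨hf, hf'⟩
    refine ⟨hf.const_smul c, ?_⟩
    convert hf'.const_smul c using 2 with z
    simp [mul_assoc]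

/-- The Hilbert space `H^{β,B}_{α,A}(W)`. -/
def HilbertStep {k : ℕ} (w : WeightPair) (W : Set (Fin k → ℝ)) (A B : ℝ) : Type :=
  ↥(hilbertSubmodule w W A B)

namespace HilbertStep

variable {k : ℕ} (w : WeightPair) (W : Set (Fin k → ℝ)) (A B : ℝ)

instance : AddCommGroup (HilbertStep w W A B) :=
  inferInstanceAs (AddCommGroup ↥(hilbertSubmodule w W A B))

instance : Module ℂ (HilbertStep w W A B) :=
  inferInstanceAs (Module ℂ ↥(hilbertSubmodule w W A B))

/-- The embedding `f ↦ f exp(-ρ_{W,A,B})` into `L²`. -/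
def toL2 : HilbertStep w W A B →ₗ[ℂ] Lp ℂ 2 (volume : Measure (Fin k → ℂ)) where
  toFun f := f.2.2.toLp _
  map_add' f g := by
    rw [← MemLp.toLp_add]
    congr 1
    funext z
    exact add_mul (f.1 z) (g.1 z) _
  map_smul' c f := by
    rw [RingHom.id_apply, ← MemLp.toLp_const_smul]
    congr 1
    funext z
    exact mul_assoc c (f.1 z) _

theorem toL2_norm (f : HilbertStep w W A B) : ‖toL2 w W A B f‖ =
    Real.sqrt (∫ z, ‖f.1 z‖ ^ 2 * Real.exp (-2 * rho w W A B z)) := by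
  have h := f.2.2
  rw [toL2, LinearMap.coe_mk, AddHom.coe_mk, Lp.norm_toLp,
    h.eLpNorm_eq_integral_rpow_norm (by norm_num) (by norm_num),
    ENNReal.toReal_ofReal (by positivity), Real.sqrt_eq_rpow]
  norm_num
  congr 1
  refine integral_congr_ae (Eventually.of_forall fun z => ?_)
  simp only [mul_pow, Complex.norm_exp]
  rw [← Real.exp_nat_mul]
  norm_num

/-- The norm `‖f‖'_{W,A,B} = (∫ |f(z)|² exp(-2ρ_{W,A,B}(z)) dλ(z))^{1/2}`. -/
def hilbertNorm : AddGroupNorm (HilbertStep w W A B) where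
  toFun f := Real.sqrt (∫ z, ‖f.1 z‖ ^ 2 * Real.exp (-2 * rho w W A B z))
  map_zero' := by rw [← toL2_norm, map_zero, norm_zero]
  add_le' f g := by
    rw [← toL2_norm, ← toL2_norm, ← toL2_norm, map_add]
    exact norm_add_le _ _
  neg' f := by rw [← toL2_norm, ← toL2_norm, map_neg, norm_neg]
  eq_zero_of_map_eq_zero' f hf := by
    rw [← toL2_norm, norm_eq_zero] at hf
    have h1 : (fun z => f.1 z * (Real.exp (-rho w W A B z) : ℂ)) =ᵐ[volume] 0 := by
      have h2 := f.2.2.coeFn_toLp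
      have h3 : f.2.2.toLp _ = 0 := hf
      rw [h3] at h2
      exact h2.symm.trans (Lp.coeFn_zero _ _ _)
    have h4 : f.1 =ᵐ[volume] 0 := by
      filter_upwards [h1] with z hz
      simpa using hz
    exact Subtype.ext (Continuous.ae_eq_iff_eq volume f.2.1.continuous continuous_zero |>.1 h4)

instance : NormedAddCommGroup (HilbertStep w W A B) := (hilbertNorm w W A B).toNormedAddCommGroup

theorem norm_def (f : HilbertStep w W A B) :
    ‖f‖ = Real.sqrt (∫ z, ‖f.1 z‖ ^ 2 * Real.exp (-2 * rho w W A B z)) := rfl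

instance : NormedSpace ℂ (HilbertStep w W A B) where
  norm_smul_le c f := by
    rw [norm_def, norm_def, ← toL2_norm, ← toL2_norm, map_smul, norm_smul]

end HilbertStep

/-! ### The unions over `A`, `B > 0` and conic neighborhoods -/

/-- The triples `(A, B, W)` with `A, B > 0` and `W` a conic neighborhood of `U`. -/
structure Index {k : ℕ} (U : NonemptyCone k) where
  A : ℝ
  B : ℝ
  W : Set (Fin k → ℝ)
  A_pos : 0 < A
  B_pos : 0 < B
  isConicNhd : IsConicNhd W U.carrier

namespace Index

variable {k : ℕ} {U : NonemptyCone k}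

/-- The whole space is a conic neighborhood of every cone. -/
instance : Nonempty (Index U) :=
  ⟨⟨1, 1, univ, one_pos, one_pos, fun _ _ _ _ => mem_univ _, by
    simp [HasOpenProjection, sdiff_eq], subset_univ _⟩⟩

theorem rho_le (w : WeightPair) {i j : Index U} (hA : i.A ≤ j.A) (hB : i.B ≤ j.B) (hW : j.W ⊆ i.W)
    (z : Fin k → ℂ) : rho w i.W i.A i.B z ≤ rho w j.W j.A j.B z := by
  have hi := i.A_pos
  have hj := j.A_pos
  have hBi := i.B_pos.le
  have hBj := j.B_pos.le
  have hne : j.W.Nonempty := U.nonempty.mono j.isConicNhd.subset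
  have h1 : w.α (‖fun l => (z l).re‖ / j.A) ≤ w.α (‖fun l => (z l).re‖ / i.A) :=
    w.α_mono (mem_Ici.2 (by positivity)) (mem_Ici.2 (by positivity)) (by gcongr)
  have h2 : w.β (i.B * ‖fun l => (z l).im‖) ≤ w.β (j.B * ‖fun l => (z l).im‖) :=
    w.β_mono (mem_Ici.2 (by positivity)) (mem_Ici.2 (by positivity)) (by gcongr)
  have hd : Metric.infDist (fun l => (z l).re) i.W ≤ Metric.infDist (fun l => (z l).re) j.W :=
    Metric.infDist_le_infDist_of_subset hW hne
  have hd0 : 0 ≤ Metric.infDist (fun l => (z l).re) i.W := Metric.infDist_nonneg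
  have hd1 : 0 ≤ Metric.infDist (fun l => (z l).re) j.W := Metric.infDist_nonneg
  have h3 : w.β (i.B * Metric.infDist (fun l => (z l).re) i.W)
      ≤ w.β (j.B * Metric.infDist (fun l => (z l).re) j.W) :=
    w.β_mono (mem_Ici.2 (by positivity)) (mem_Ici.2 (by positivity)) (by gcongr)
  unfold rho
  linarith

/-- An upper bound of two indices. -/
def sup (i j : Index U) : Index U where
  A := max i.A j.A
  B := max i.B j.B
  W := i.W ∩ j.W
  A_pos := lt_max_of_lt_left i.A_pos
  B_pos := lt_max_of_lt_left i.B_pos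
  isConicNhd :=
    ⟨fun x hx t ht => ⟨i.isConicNhd.isCone x hx.1 t ht, j.isConicNhd.isCone x hx.2 t ht⟩, by
      have h : IsOpen ((i.W \ {0}) ∩ (j.W \ {0})) :=
        i.isConicNhd.isOpen.inter j.isConicNhd.isOpen
      have h' : (i.W \ {0}) ∩ (j.W \ {0}) = (i.W ∩ j.W) \ {0} := by ext x; simp; tauto
      rwa [h'] at h,
      subset_inter i.isConicNhd.subset j.isConicNhd.subset⟩

end Index

variable {k : ℕ} (w : WeightPair) (U : NonemptyCone k)

theorem supSubmodule_mono {i j : Index U} (hA : i.A ≤ j.A) (hB : i.B ≤ j.B) (hW : j.W ⊆ i.W) :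
    supSubmodule w i.W i.A i.B ≤ supSubmodule w j.W j.A j.B := by
  rintro f ⟨hf, a, ha⟩
  refine ⟨hf, a, ?_⟩
  rintro _ ⟨z, rfl⟩
  refine le_trans ?_ (ha ⟨z, rfl⟩)
  have := Index.rho_le w hA hB hW z
  dsimp only
  gcongr

theorem continuous_rho (i : Index U) : Continuous (rho w i.W i.A i.B) := by
  have hA := i.A_pos
  have hB := i.B_pos.le
  have hre : Continuous fun z : Fin k → ℂ => fun l => (z l).re := by fun_prop
  have him : Continuous fun z : Fin k → ℂ => fun l => (z l).im := by fun_prop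
  have hd := (Metric.continuous_infDist_pt i.W).comp hre
  refine ((w.α_cont.comp_continuous (hre.norm.div_const i.A) fun z => ?_).neg.add
    (w.β_cont.comp_continuous (continuous_const (y := i.B) |>.mul him.norm) fun z => ?_)).add
    (w.β_cont.comp_continuous (continuous_const (y := i.B) |>.mul hd) fun z => ?_)
  · exact mem_Ici.2 (div_nonneg (norm_nonneg _) hA.le)
  · exact mem_Ici.2 (mul_nonneg hB (norm_nonneg _))
  · exact mem_Ici.2 (mul_nonneg hB Metric.infDist_nonneg)

theorem hilbertSubmodule_mono {i j : Index U} (hA : i.A ≤ j.A) (hB : i.B ≤ j.B) (hW : j.W ⊆ i.W) :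
    hilbertSubmodule w i.W i.A i.B ≤ hilbertSubmodule w j.W j.A j.B := by
  rintro f ⟨hf, hf'⟩
  refine ⟨hf, hf'.mono ?_ (Eventually.of_forall fun z => ?_)⟩
  · have := continuous_rho w U j
    have := hf.continuous
    exact Continuous.aestronglyMeasurable (by fun_prop)
  · have := Index.rho_le w hA hB hW z
    rw [norm_mul, norm_mul, Complex.norm_real, Complex.norm_real, Real.norm_eq_abs,
      Real.norm_eq_abs, Real.abs_exp, Real.abs_exp]
    gcongr

/-- The union of the spaces `𝓔^{β,B}_{α,A}(W)`, as a space of functions. -/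
def supUnion : Submodule ℂ ((Fin k → ℂ) → ℂ) where
  carrier := ⋃ i : Index U, (supSubmodule w i.W i.A i.B : Set ((Fin k → ℂ) → ℂ))
  zero_mem' := mem_iUnion.2 ⟨Classical.arbitrary _, Submodule.zero_mem _⟩
  add_mem' := by
    intro f g hf hg
    obtain ⟨i, hi⟩ := mem_iUnion.1 hf
    obtain ⟨j, hj⟩ := mem_iUnion.1 hg
    exact mem_iUnion.2 ⟨i.sup j, Submodule.add_mem _
      (supSubmodule_mono w U (le_max_left _ _) (le_max_left _ _) inter_subset_left hi)
      (supSubmodule_mono w U (le_max_right _ _) (le_max_right _ _) inter_subset_right hj)⟩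
  smul_mem' := by
    intro c f hf
    obtain ⟨i, hi⟩ := mem_iUnion.1 hf
    exact mem_iUnion.2 ⟨i, Submodule.smul_mem _ c hi⟩

/-- The union of the spaces `H^{β,B}_{α,A}(W)`, as a space of functions. -/
def hilbertUnion : Submodule ℂ ((Fin k → ℂ) → ℂ) where
  carrier := ⋃ i : Index U, (hilbertSubmodule w i.W i.A i.B : Set ((Fin k → ℂ) → ℂ))
  zero_mem' := mem_iUnion.2 ⟨Classical.arbitrary _, Submodule.zero_mem _⟩
  add_mem' := by
    intro f g hf hg
    obtain ⟨i, hi⟩ := mem_iUnion.1 hf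
    obtain ⟨j, hj⟩ := mem_iUnion.1 hg
    exact mem_iUnion.2 ⟨i.sup j, Submodule.add_mem _
      (hilbertSubmodule_mono w U (le_max_left _ _) (le_max_left _ _) inter_subset_left hi)
      (hilbertSubmodule_mono w U (le_max_right _ _) (le_max_right _ _) inter_subset_right hj)⟩
  smul_mem' := by
    intro c f hf
    obtain ⟨i, hi⟩ := mem_iUnion.1 hf
    exact mem_iUnion.2 ⟨i, Submodule.smul_mem _ c hi⟩

/-- The space `𝓔^β_α(U)`. -/
def SupSpace : Type := ↥(supUnion w U)

/-- The union of the spaces `H^{β,B}_{α,A}(W)`. -/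
def HilbertSpaceUnion : Type := ↥(hilbertUnion w U)

instance : AddCommGroup (SupSpace w U) := inferInstanceAs (AddCommGroup ↥(supUnion w U))

instance : Module ℂ (SupSpace w U) := inferInstanceAs (Module ℂ ↥(supUnion w U))

instance : AddCommGroup (HilbertSpaceUnion w U) :=
  inferInstanceAs (AddCommGroup ↥(hilbertUnion w U))

instance : Module ℂ (HilbertSpaceUnion w U) := inferInstanceAs (Module ℂ ↥(hilbertUnion w U))

/-- The inclusion `𝓔^{β,B}_{α,A}(W) → 𝓔^β_α(U)`. -/
def supIncl (i : Index U) : SupStep w i.W i.A i.B →ₗ[ℂ] SupSpace w U :=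
  Submodule.inclusion (p := supSubmodule w i.W i.A i.B) (p' := supUnion w U)
    fun _ hf => mem_iUnion.2 ⟨i, hf⟩

/-- The inclusion of `H^{β,B}_{α,A}(W)` into the union. -/
def hilbertIncl (i : Index U) : HilbertStep w i.W i.A i.B →ₗ[ℂ] HilbertSpaceUnion w U :=
  Submodule.inclusion (p := hilbertSubmodule w i.W i.A i.B) (p' := hilbertUnion w U)
    fun _ hf => mem_iUnion.2 ⟨i, hf⟩

/-- `𝓔^β_α(U)` carries the inductive limit topology. -/
instance : TopologicalSpace (SupSpace w U) :=
  inductiveLimitTopology (fun i : Index U => SupStep w i.W i.A i.B) (supIncl w U)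

/-- The union of the Hilbert spaces carries the inductive limit topology. -/
instance : TopologicalSpace (HilbertSpaceUnion w U) :=
  inductiveLimitTopology (fun i : Index U => HilbertStep w i.W i.A i.B) (hilbertIncl w U)

end ConeSpaces

end

noncomputable section

namespace ConeSpaces

section

/-! ### Inductive limits -/

section InductiveLimit

variable {ι κ : Type*} {X : ι → Type*} [∀ i, AddCommGroup (X i)] [∀ i, Module ℂ (X i)]
  [∀ i, TopologicalSpace (X i)] {Y : κ → Type*} [∀ i, AddCommGroup (Y i)] [∀ i, Module ℂ (Y i)]
  [∀ i, TopologicalSpace (Y i)] {E F : Type*} [AddCommGroup E] [Module ℂ E]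
  (φ : ∀ i, X i →ₗ[ℂ] E) (ψ : ∀ i, Y i →ₗ[ℂ] E)

/-! Everything rests on one relation between indices: `i.Doubles j` means that `A` and `B` at least
double while the neighborhood shrinks up to closure. Up to additive constants, ρ_j then dominates
ρ_i in two ways: ρ_j(z) bounds ρ_i on the whole unit polydisc around z (`exists_rho_shift_le`), and
it exceeds ρ_i(z) + N log(1 + |z|) for any N (`exists_rho_add_log_le`). The second bound holds
because α(2t) - α(t) and β(2t) - β(t) grow at least like a power of t.

The logarithmic gain makes exp(2(ρ_i - ρ_j)) integrable, so the sup-norm step i embeds continuously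
in the Hilbert step j. The shift bound and the mean value property applied to f² embed the Hilbert
step i in the sup-norm step j. The two systems interleave, which proves (1) for every U.

Evaluation at z on a Hilbert step is bounded by a multiple of exp ρ_j(z), hence so is the square
root of ∑ |e(z)|² over any finite orthonormal system. Integration shows that two successive
doublings give a Hilbert–Schmidt inclusion; a product of two such inclusions has a nuclear expansion
and is compact. Countable generation supplies a cofinal sequence of Hilbert steps linked in this
way, which is the DFS property.

For nuclearity, a continuous map u on the limit has a nuclear expansion on each step, since it
factors through the next one. After rescaling, these expansions glue to a map on the Hilbert sum of
the steps. The limit is a quotient of the algebraic direct sum, and projecting away the closed span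
of the relations factors u through the glued map (`isNuclearMap_of_inductiveLimit`).

For (3), a cone with open projection is its own smallest conic neighborhood; for a closed cone,
compactness of the sphere shows that shrinking angular neighborhoods suffice. -/

theorem isTopologicalAddGroup_inductiveLimit :
    @IsTopologicalAddGroup E (inductiveLimitTopology X φ) _ :=
  topologicalAddGroup_sInf fun _ ht => ht.1

theorem continuousSMul_inductiveLimit :
    @ContinuousSMul ℂ E _ _ (inductiveLimitTopology X φ) :=
  continuousSMul_sInf fun _ ht => ht.2.1

theorem locallyConvexSpace_inductiveLimit :
    @LocallyConvexSpace ℝ E _ _ _ _ (inductiveLimitTopology X φ) :=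
  LocallyConvexSpace.sInf fun _ ht => ht.2.2.1

theorem continuous_inductiveLimit_map (i : ι) :
    @Continuous (X i) E _ (inductiveLimitTopology X φ) (φ i) :=
  continuous_sInf_rng.2 fun _ ht => ht.2.2.2 i

/-- The universal property of the inductive limit topology. -/
theorem continuous_of_inductiveLimit [AddCommGroup F] [Module ℂ F] [tF : TopologicalSpace F]
    [IsTopologicalAddGroup F] [ContinuousSMul ℂ F] [LocallyConvexSpace ℝ F] (u : E →ₗ[ℂ] F)
    (h : ∀ i, Continuous fun x => u (φ i x)) :
    @Continuous E F (inductiveLimitTopology X φ) _ u := by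
  refine continuous_sInf_dom (t := TopologicalSpace.induced u tF) ⟨?_, ?_, ?_, fun i => ?_⟩
    continuous_induced_dom
  · exact topologicalAddGroup_induced u
  · exact continuousSMul_induced u
  · exact LocallyConvexSpace.induced (u.restrictScalars ℝ)
  · exact continuous_induced_rng.2 (h i)

theorem continuous_of_inductiveLimit_normed [NormedAddCommGroup F] [NormedSpace ℂ F]
    (u : E →ₗ[ℂ] F) (h : ∀ i, Continuous fun x => u (φ i x)) :
    @Continuous E F (inductiveLimitTopology X φ) _ u :=
  continuous_of_inductiveLimit φ u h

/-- Each `φ i` factors continuously through some `ψ j`, so every topology admissible for `ψ` is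
admissible for `φ`. Two interleaved systems therefore define the same limit topology. -/
theorem inductiveLimitTopology_le
    (h : ∀ i, ∃ (j : κ) (T : X i → Y j), Continuous T ∧ ∀ x, ψ j (T x) = φ i x) :
    inductiveLimitTopology X φ ≤ inductiveLimitTopology Y ψ := by
  refine sInf_le_sInf fun t ht => ⟨ht.1, ht.2.1, ht.2.2.1, fun i => ?_⟩
  obtain ⟨j, T, hT, h⟩ := h i
  have : (φ i : X i → E) = ψ j ∘ T := funext fun x => (h x).symm
  rw [this]
  exact (ht.2.2.2 j).comp hT

end InductiveLimit

/-! ### Nuclear expansions and Hilbert–Schmidt operators -/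

section Nuclear

variable {X Y Z : Type} [NormedAddCommGroup X] [NormedSpace ℂ X] [NormedAddCommGroup Y]
  [NormedSpace ℂ Y] [NormedAddCommGroup Z] [NormedSpace ℂ Z]

/-- `T x = ∑ i, f i x • y i` with `∑ i, ‖f i‖ * ‖y i‖ < ∞`. -/
def HasNuclearExpansion (T : X →L[ℂ] Y) : Prop :=
  ∃ (ι : Type) (f : ι → X →L[ℂ] ℂ) (y : ι → Y), Summable (fun i => ‖f i‖ * ‖y i‖) ∧
    ∀ x, HasSum (fun i => f i x • y i) (T x)

theorem HasNuclearExpansion.comp_left {T : X →L[ℂ] Y} (h : HasNuclearExpansion T)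
    (S : Y →L[ℂ] Z) : HasNuclearExpansion (S.comp T) := by
  obtain ⟨ι, f, y, hs, hT⟩ := h
  refine ⟨ι, f, fun i => S (y i), ?_, fun x => ?_⟩
  · refine Summable.of_nonneg_of_le (fun i => by positivity) (fun i => ?_) (hs.mul_left ‖S‖)
    calc ‖f i‖ * ‖S (y i)‖ ≤ ‖f i‖ * (‖S‖ * ‖y i‖) := by gcongr; exact S.le_opNorm _
      _ = ‖S‖ * (‖f i‖ * ‖y i‖) := by ring
  · simpa using S.hasSum (hT x)

theorem summable_smulRight [CompleteSpace Y] {ι : Type*} {f : ι → X →L[ℂ] ℂ} {y : ι → Y}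
    (hs : Summable fun i => ‖f i‖ * ‖y i‖) : Summable fun i => (f i).smulRight (y i) :=
  Summable.of_norm_bounded hs fun i => by rw [ContinuousLinearMap.norm_smulRight_apply]

theorem exists_hasSum_of_summable [CompleteSpace Y] {ι : Type*} {f : ι → X →L[ℂ] ℂ} {y : ι → Y}
    (hs : Summable fun i => ‖f i‖ * ‖y i‖) :
    ∃ V : X →L[ℂ] Y, ∀ x, HasSum (fun i => f i x • y i) (V x) :=
  ⟨∑' i, (f i).smulRight (y i), fun x => by
    simpa using (ContinuousLinearMap.apply ℂ Y x).hasSum (summable_smulRight hs).hasSum⟩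

/-- The expansion converges in operator norm, so `T` is a norm limit of finite-rank operators. -/
theorem HasNuclearExpansion.isCompactOperator [CompleteSpace Y] {T : X →L[ℂ] Y}
    (h : HasNuclearExpansion T) : IsCompactOperator T := by
  obtain ⟨ι, f, y, hs, hT⟩ := h
  have hS := (summable_smulRight hs).hasSum
  have hTS : T = ∑' i, (f i).smulRight (y i) := by
    ext x
    refine (hT x).unique ?_
    simpa using (ContinuousLinearMap.apply ℂ Y x).hasSum hS
  rw [← hTS] at hS
  refine isCompactOperator_of_tendsto hS (Eventually.of_forall fun s => ?_)
  refine Submodule.sum_mem (compactOperator (RingHom.id ℂ) X Y) fun i _ => ?_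
  exact (isCompactOperator_of_locallyCompactSpace_dom (f i)).clm_comp
    (ContinuousLinearMap.toSpanSingleton ℂ (y i))

theorem HasNuclearExpansion.isNuclearMap_comp {E : Type} [AddCommGroup E] [Module ℂ E]
    [TopologicalSpace E] {T : X →L[ℂ] Y} (h : HasNuclearExpansion T) (s : E →L[ℂ] X) :
    IsNuclearMap (T.comp s) := by
  obtain ⟨ι, f, y, hs, hT⟩ := h
  -- Only the nonzero terms are kept: there are countably many, and for them `f i` and `y i` can be
  -- normalized, the norms moving into the coefficient. The resulting sequences are padded by 0 off
  -- the range of `e`.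
  set S := Function.support fun i => ‖f i‖ * ‖y i‖ with hS
  have : Countable S := hs.countable_support
  obtain ⟨e, he⟩ := exists_injective_nat S
  refine ⟨Function.extend e (fun i => ((‖f i‖ * ‖y i‖ : ℝ) : ℂ)) 0,
    Function.extend e (fun i => ((‖f i‖⁻¹ : ℝ) : ℂ) • (f i).comp s) 0,
    Function.extend e (fun i => ((‖y i‖⁻¹ : ℝ) : ℂ) • y i) 0, ?_, ?_, ?_, fun x => ?_⟩
  · have h1 : Summable fun i : S => ‖((‖f i‖ * ‖y i‖ : ℝ) : ℂ)‖ :=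
      (hs.subtype S).congr fun i => by simp
    refine (he.summable_iff fun n hn => ?_).1 (h1.congr fun i => ?_)
    · rw [Function.extend_apply' _ _ _ fun ⟨a, ha⟩ => hn ⟨a, ha⟩]; simp
    · simp only [Function.comp_apply]; rw [he.extend_apply]
  · intro x₀
    refine Metric.equicontinuousAt_of_continuity_modulus (fun x => dist (s x₀) (s x)) ?_ _
      (Eventually.of_forall fun x n => ?_)
    · have : Continuous fun x => dist (s x₀) (s x) := by fun_prop
      simpa using this.tendsto x₀
    · by_cases hn : ∃ i, e i = n
      · obtain ⟨i, rfl⟩ := hn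
        rw [he.extend_apply]
        simp only [_root_.smul_apply, ContinuousLinearMap.comp_apply]
        rw [dist_smul₀, dist_eq_norm, ← map_sub, dist_eq_norm, Complex.norm_real, norm_inv,
          norm_norm]
        have h0 : ‖f i‖ ≠ 0 := fun h => i.2 (by simp [h])
        calc ‖f i‖⁻¹ * ‖f i (s x₀ - s x)‖ ≤ ‖f i‖⁻¹ * (‖f i‖ * ‖s x₀ - s x‖) := by
              gcongr; exact (f i).le_opNorm _
          _ = _ := by rw [inv_mul_cancel_left₀ h0]
      · rw [Function.extend_apply' _ _ _ hn]
        simp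
  · refine (isBounded_iff_forall_norm_le.2 ⟨1, ?_⟩)
    rintro _ ⟨n, rfl⟩
    by_cases hn : ∃ i, e i = n
    · obtain ⟨i, rfl⟩ := hn
      rw [he.extend_apply, norm_smul, Complex.norm_real, norm_inv, norm_norm]
      exact inv_mul_le_one
    · rw [Function.extend_apply' _ _ _ hn]
      simp
  · have h1 : HasSum (fun i : S => f i (s x) • y i) (T (s x)) := by
      refine (hasSum_subtype_iff_of_support_subset fun i hi => ?_).2 (hT (s x))
      rw [hS, Function.mem_support]
      intro h0
      rcases mul_eq_zero.1 h0 with h0 | h0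
      · exact hi (by simp [norm_eq_zero.1 h0])
      · exact hi (by simp [norm_eq_zero.1 h0])
    refine (he.hasSum_iff fun n hn => ?_).1 (h1.congr_fun fun i => ?_)
    · rw [Function.extend_apply' _ _ _ fun ⟨a, ha⟩ => hn ⟨a, ha⟩]; simp
    · simp only [Function.comp_apply, he.extend_apply, _root_.smul_apply,
        ContinuousLinearMap.comp_apply, smul_smul, smul_eq_mul]
      have h0 : (‖f i‖ : ℂ) ≠ 0 := Complex.ofReal_ne_zero.2 (left_ne_zero_of_mul i.2)
      have h0' : (‖y i‖ : ℂ) ≠ 0 := Complex.ofReal_ne_zero.2 (right_ne_zero_of_mul i.2)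
      congr 1
      push_cast
      field_simp

end Nuclear

section HilbertSchmidt

variable {X Y Z : Type} [NormedAddCommGroup X] [InnerProductSpace ℂ X] [NormedAddCommGroup Y]
  [InnerProductSpace ℂ Y] [NormedAddCommGroup Z] [NormedSpace ℂ Z]

/-- The sums `∑ ‖T e‖ ^ 2` over finite orthonormal systems are bounded. -/
def IsHilbertSchmidt (T : X →L[ℂ] Z) : Prop :=
  ∃ C : ℝ, ∀ s : Finset X, Orthonormal ℂ ((↑) : s → X) → ∑ x ∈ s, ‖T x‖ ^ 2 ≤ C

theorem IsHilbertSchmidt.sum_le {T : X →L[ℂ] Z} {C : ℝ}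
    (h : ∀ s : Finset X, Orthonormal ℂ ((↑) : s → X) → ∑ x ∈ s, ‖T x‖ ^ 2 ≤ C) {w : Set X}
    (hw : Orthonormal ℂ ((↑) : w → X)) (s : Finset w) : ∑ x ∈ s, ‖T x‖ ^ 2 ≤ C := by
  have h1 := h (s.map (Function.Embedding.subtype _)) ?_
  · simpa using h1
  · have hmem : ∀ x : s.map (Function.Embedding.subtype (· ∈ w)), (x : X) ∈ w := fun x => by
      obtain ⟨a, _, ha⟩ := Finset.mem_map.1 x.2
      rw [← ha]; exact a.2
    exact hw.comp (fun x : s.map (Function.Embedding.subtype (· ∈ w)) => ⟨x, hmem x⟩) fun x y hxy =>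
      Subtype.ext (congrArg (fun z : w => (z : X)) hxy)

/-- Parseval in `X` expands each ‖T* y‖² as a sum of |⟨T a, y⟩|² over a Hilbert basis; after
exchanging the sums, Bessel's inequality for the system `s` bounds the terms by ‖T a‖². The constant
is preserved. -/
theorem IsHilbertSchmidt.adjoint [CompleteSpace X] [CompleteSpace Y] {T : X →L[ℂ] Y}
    (h : IsHilbertSchmidt T) : IsHilbertSchmidt (ContinuousLinearMap.adjoint T) := by
  obtain ⟨C, hC⟩ := h
  refine ⟨C, fun s hs => ?_⟩
  obtain ⟨w, b, hb⟩ := exists_hilbertBasis ℂ X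
  have hbo : Orthonormal ℂ ((↑) : w → X) := hb ▸ b.orthonormal
  have h1 : ∀ y : Y, HasSum (fun a : w => ‖inner ℂ (T a) y‖ ^ 2)
      (‖ContinuousLinearMap.adjoint T y‖ ^ 2) := by
    intro y
    have h2 := b.hasSum_inner_mul_inner (ContinuousLinearMap.adjoint T y)
      (ContinuousLinearMap.adjoint T y)
    have h3 := Complex.hasSum_re h2
    rw [← inner_self_eq_norm_sq (𝕜 := ℂ)]
    refine h3.congr_fun fun a => ?_
    rw [hb, ← ContinuousLinearMap.adjoint_inner_right]
    refine ((inner_mul_symm_re_eq_norm (𝕜 := ℂ) _ _).trans ?_).symm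
    rw [norm_mul, norm_inner_symm _ (a : X), sq]
  refine hasSum_le_of_sum_le (hasSum_sum fun y _ => h1 y) fun t => ?_
  refine le_trans (Finset.sum_le_sum fun a _ => ?_) (IsHilbertSchmidt.sum_le hC hbo t)
  have h4 := hs.sum_inner_products_le (T a) (s := Finset.univ)
  rw [← Finset.sum_coe_sort]
  refine le_trans (Finset.sum_le_sum fun y _ => ?_) h4
  rw [norm_inner_symm]

/-- Expanding `T x` in a Hilbert basis (a) of the middle space gives S T x = ∑ ⟨T* a, x⟩ S a, and
‖T* a‖ ‖S a‖ is summable because both factors are square summable. -/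
theorem IsHilbertSchmidt.hasNuclearExpansion_comp [CompleteSpace X] [CompleteSpace Y]
    {S : Y →L[ℂ] Z} {T : X →L[ℂ] Y} (hS : IsHilbertSchmidt S) (hT : IsHilbertSchmidt T) :
    HasNuclearExpansion (S.comp T) := by
  obtain ⟨C, hC⟩ := hS
  obtain ⟨C', hC'⟩ := hT.adjoint
  obtain ⟨w, b, hb⟩ := exists_hilbertBasis ℂ Y
  have hbo : Orthonormal ℂ ((↑) : w → Y) := hb ▸ b.orthonormal
  refine ⟨w, fun a => innerSL ℂ (ContinuousLinearMap.adjoint T a), fun a => S a, ?_, fun x => ?_⟩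
  · have h1 : Summable fun a : w => ‖S a‖ ^ 2 :=
      summable_of_sum_le (fun _ => by positivity) fun s => IsHilbertSchmidt.sum_le hC hbo s
    have h2 : Summable fun a : w => ‖ContinuousLinearMap.adjoint T a‖ ^ 2 :=
      summable_of_sum_le (fun _ => by positivity) fun s => IsHilbertSchmidt.sum_le hC' hbo s
    refine Summable.of_nonneg_of_le (fun _ => by positivity) (fun a => ?_) (h1.add h2)
    rw [innerSL_apply_norm]
    nlinarith [sq_nonneg (‖ContinuousLinearMap.adjoint T a‖ - ‖S a‖),
      sq_nonneg ‖ContinuousLinearMap.adjoint T a‖, sq_nonneg ‖S a‖]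
  · have h1 := S.hasSum (b.hasSum_repr (T x))
    refine h1.congr_fun fun a => ?_
    simp [b.repr_apply_apply, hb, ContinuousLinearMap.adjoint_inner_left]

end HilbertSchmidt

/-! ### Nuclear maps on inductive limits of sequences of Hilbert spaces -/

section NuclearLimit

open scoped DirectSum

variable {X : ℕ → Type} [∀ n, NormedAddCommGroup (X n)] [∀ n, InnerProductSpace ℂ (X n)]
  {F : Type} [NormedAddCommGroup F] [NormedSpace ℂ F] [CompleteSpace F]

theorem summable_sigma_mul {ι : ℕ → Type} {c : (n : ℕ) → ι n → ℝ} (hc : ∀ n i, 0 ≤ c n i)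
    (hs : ∀ n, Summable (c n)) {a : ℕ → ℝ} (ha : ∀ n, 0 ≤ a n)
    (h : Summable fun n => a n * ∑' i, c n i) :
    Summable fun p : Sigma ι => a p.1 * c p.1 p.2 := by
  refine (summable_sigma_of_nonneg fun p => mul_nonneg (ha _) (hc _ _)).2 ⟨fun n => ?_, ?_⟩
  · exact Summable.mul_left (a n) (hs n)
  · exact h.congr fun n => tsum_mul_left.symm

theorem exists_pos_summable_inv_mul {S : ℕ → ℝ} (hS : ∀ n, 0 ≤ S n) :
    ∃ μ : ℕ → ℝ, (∀ n, 0 < μ n) ∧ Summable fun n => (μ n)⁻¹ * S n := by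
  have hμ : ∀ n : ℕ, 0 < 2 ^ n * (1 + S n) := fun n => by have := hS n; positivity
  refine ⟨fun n => 2 ^ n * (1 + S n), hμ, Summable.of_nonneg_of_le
    (fun n => mul_nonneg (inv_nonneg.2 (hμ n).le) (hS n)) (fun n => ?_) summable_geometric_two⟩
  have := hS n
  rw [mul_inv, one_div, inv_pow, mul_assoc]
  refine mul_le_of_le_one_right (by positivity) ?_
  rw [inv_mul_le_iff₀ (by positivity)]
  linarith

theorem norm_comp_evalCLM_le {n : ℕ} (f : X n →L[ℂ] ℂ) : ‖f.comp (lp.evalCLM ℂ X 2 n)‖ ≤ ‖f‖ := by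
  refine ContinuousLinearMap.opNorm_le_bound _ (norm_nonneg _) fun d => ?_
  exact (f.le_opNorm _).trans
    (mul_le_mul_of_nonneg_left (lp.norm_apply_le_norm two_ne_zero d n) (norm_nonneg _))

/-- Functionals on the summands extend to the Hilbert sum through the coordinate projections without
increase of norm, so all the expansions merge into one summable series. -/
theorem exists_hasNuclearExpansion_lp_of_summable {ι : ℕ → Type} {f : ∀ n, ι n → X n →L[ℂ] ℂ}
    {y : ∀ n, ι n → F} (h : Summable fun p : Sigma ι => ‖f p.1 p.2‖ * ‖y p.1 p.2‖) :
    ∃ V : lp X 2 →L[ℂ] F, HasNuclearExpansion V ∧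
      ∀ n x, HasSum (fun i => f n i x • y n i) (V (lp.single 2 n x)) := by
  have hg : Summable fun p : Sigma ι =>
      ‖(f p.1 p.2).comp (lp.evalCLM ℂ X 2 p.1)‖ * ‖y p.1 p.2‖ :=
    Summable.of_nonneg_of_le (fun p => by positivity)
      (fun p => mul_le_mul_of_nonneg_right (norm_comp_evalCLM_le _) (norm_nonneg _)) h
  obtain ⟨V, hV⟩ := exists_hasSum_of_summable hg
  refine ⟨V, ⟨_, _, _, hg, hV⟩, fun n x => ?_⟩
  refine ((sigma_mk_injective (i := n)).hasSum_iff fun p hp => ?_).2 (hV (lp.single 2 n x))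
    |>.congr_fun fun i => ?_
  · have hne : p.1 ≠ n := by
      rintro rfl
      exact hp ⟨p.2, rfl⟩
    have h0 : (f p.1 p.2).comp (lp.evalCLM ℂ X 2 p.1) (lp.single 2 n x) = 0 := by
      change f p.1 p.2 (lp.single 2 n x p.1) = 0
      rw [lp.single_apply_ne _ _ _ hne, map_zero]
    rw [h0, zero_smul]
  · change _ = f n i (lp.single 2 n x n) • y n i
    rw [lp.single_apply_self]

/-- Maps with nuclear expansions on the summands extend, after rescaling, to a map with a nuclear
expansion on the Hilbert sum. -/
theorem exists_hasNuclearExpansion_lp {v : ∀ n, X n →L[ℂ] F}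
    (hv : ∀ n, HasNuclearExpansion (v n)) :
    ∃ (μ : ℕ → ℂ) (V : lp X 2 →L[ℂ] F), HasNuclearExpansion V ∧
      ∀ n x, V (lp.single 2 n (μ n • x)) = v n x := by
  choose ι f y hs hsum using hv
  obtain ⟨μ, hμ, hμS⟩ := exists_pos_summable_inv_mul
    (S := fun n => ∑' i, ‖f n i‖ * ‖y n i‖) fun n => tsum_nonneg fun i => by positivity
  have h1 := summable_sigma_mul (fun n i => by positivity) hs (fun n => inv_nonneg.2 (hμ n).le) hμS
  obtain ⟨V, hV, hVs⟩ := exists_hasNuclearExpansion_lp_of_summable (f := f)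
    (y := fun n i => (((μ n)⁻¹ : ℝ) : ℂ) • y n i) (h1.congr fun p => by
      rw [norm_smul, Complex.norm_real, Real.norm_eq_abs, abs_inv, abs_of_pos (hμ p.1)]
      ring)
  refine ⟨fun n => (μ n : ℂ), V, hV, fun n x => ?_⟩
  refine (hVs n ((μ n : ℂ) • x)).unique ((hsum n x).congr_fun fun i => ?_)
  rw [map_smul, smul_smul, smul_eq_mul, mul_right_comm, ← Complex.ofReal_mul,
    mul_inv_cancel₀ (hμ n).ne', Complex.ofReal_one, one_mul]

/-- A continuous linear map on an inductive limit of a sequence of Hilbert spaces is nuclear if its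
restriction to each step has a nuclear expansion. -/
theorem isNuclearMap_of_inductiveLimit [∀ n, CompleteSpace (X n)] {E : Type} [AddCommGroup E] [Module ℂ E]
    [tE : TopologicalSpace E] (φ : ∀ n, X n →ₗ[ℂ] E) (hE : tE = inductiveLimitTopology X φ)
    (hφ : ∀ e, ∃ n x, φ n x = e) (u : E →L[ℂ] F)
    (hu : ∀ n, ∃ v : X n →L[ℂ] F, HasNuclearExpansion v ∧ ∀ x, v x = u (φ n x)) :
    IsNuclearMap u := by
  choose v hv hvu using hu
  obtain ⟨μ, V, hV, hVv⟩ := exists_hasNuclearExpansion_lp hv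
  let a : (⨁ n, X n) →ₗ[ℂ] lp X 2 :=
    DirectSum.toModule ℂ ℕ _ fun n => μ n • lp.lsingle (𝕜 := ℂ) 2 n
  let b : (⨁ n, X n) →ₗ[ℂ] E := DirectSum.toModule ℂ ℕ _ φ
  have hb : Function.Surjective b := fun e => by
    obtain ⟨n, x, rfl⟩ := hφ e
    exact ⟨DirectSum.lof ℂ ℕ X n x, DirectSum.toModule_lof ℂ n x⟩
  -- `r` is a merely algebraic section of `b`, with no continuity. Its ambiguity lies in `b.ker`,
  -- and the projection `P` below removes it.
  obtain ⟨r, hr⟩ := b.exists_rightInverse_of_surjective (LinearMap.range_eq_top.2 hb)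
  have hab : ∀ g, V (a g) = u (b g) := by
    have : (V : lp X 2 →ₗ[ℂ] F) ∘ₗ a = (u : E →ₗ[ℂ] F) ∘ₗ b := by
      refine DirectSum.linearMap_ext _ fun n => LinearMap.ext fun x => ?_
      simp only [LinearMap.comp_apply, a, b, DirectSum.toModule_lof]
      change V (μ n • lp.single 2 n x) = u (φ n x)
      rw [← lp.single_smul, hVv, hvu]
    exact fun g => LinearMap.congr_fun this g
  set N : Submodule ℂ (lp X 2) := (b.ker.map a).topologicalClosure
  -- Projecting away `N` loses nothing for `V`: by `hab`, `V` kills the image of `b.ker`, hence its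
  -- closure.
  have hN : ∀ d ∈ N, V d = 0 := by
    have : N ≤ (V : lp X 2 →ₗ[ℂ] F).ker := by
      refine Submodule.topologicalClosure_minimal _ ?_ V.isClosed_ker
      rintro _ ⟨g, hg, rfl⟩
      change V (a g) = 0
      rw [hab, show b g = 0 from hg, map_zero]
    exact fun d hd => this hd
  have : CompleteSpace N := (Submodule.isClosed_topologicalClosure _).completeSpace_coe
  let P : lp X 2 →L[ℂ] lp X 2 := ContinuousLinearMap.id ℂ _ - N.starProjection
  let s₀ : E →ₗ[ℂ] lp X 2 := (P : lp X 2 →ₗ[ℂ] lp X 2) ∘ₗ a ∘ₗ r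
  have hP : ∀ d ∈ N, P d = 0 := fun d hd => by
    simp [P, Submodule.starProjection_eq_self_iff.2 hd]
  -- On each step `r` disappears: `r (φ n x)` and the copy of `x` in the direct sum differ by an
  -- element of `b.ker`. Continuity of `s₀` can then be checked step by step.
  have hs₀ : ∀ n x, s₀ (φ n x) = P (μ n • lp.single 2 n x) := fun n x => by
    have h1 : a (r (φ n x)) - μ n • lp.single 2 n x ∈ N := by
      refine Submodule.le_topologicalClosure _
        ⟨r (φ n x) - DirectSum.lof ℂ ℕ X n x, ?_, ?_⟩
      · change b _ = 0
        rw [map_sub, sub_eq_zero]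
        refine (LinearMap.congr_fun hr (φ n x)).trans ?_
        exact (DirectSum.toModule_lof ℂ n x).symm
      · rw [map_sub]
        congr 1
        exact DirectSum.toModule_lof ℂ n x
    have h2 := hP _ h1
    rw [map_sub, sub_eq_zero] at h2
    exact h2
  let s : E →L[ℂ] lp X 2 := ⟨s₀, by
    rw [hE]
    refine continuous_of_inductiveLimit_normed φ s₀ fun n => ?_
    simp only [hs₀]
    exact P.continuous.comp
      ((lp.singleContinuousLinearMap ℂ X 2 n).continuous.const_smul (μ n))⟩
  have hVs : u = V.comp s := by
    ext e
    change u e = V (a (r e) - N.starProjection (a (r e)))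
    rw [map_sub, hN _ (N.starProjection_apply_mem _), sub_zero, hab]
    exact congrArg u (LinearMap.congr_fun hr e).symm
  rw [hVs]
  exact hV.isNuclearMap_comp s

end NuclearLimit

end

section

/-! ### Estimates for the weights -/

/-- For large `s` the gain c (a s)^κ from doubling the argument beats any multiple of the logarithm;
on the remaining bounded range monotonicity gives a constant. -/
theorem exists_add_log_le {g : ℝ → ℝ} (hg : MonotoneOn g (Ici 0)) {κ c S : ℝ} (hκ : 0 < κ)
    (hc : 0 < c) (hgS : ∀ t, S ≤ t → c * t ^ κ ≤ g (2 * t) - g t) {a b N : ℝ} (ha : 0 < a)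
    (hab : 2 * a ≤ b) (hN : 0 ≤ N) :
    ∃ C, ∀ s, 0 ≤ s → g (a * s) + N * Real.log (1 + s) ≤ g (b * s) + C := by
  have hb : 0 < b := by linarith
  -- Chosen so that (N + 1) ε (2 / a)^κ = c, in view of 1 + s ≤ (2 / a)(a s) for s ≥ 1. Using N + 1
  -- instead of N covers N = 0.
  set ε := c / ((N + 1) * (2 / a) ^ κ)
  have hε : 0 < ε := by positivity
  have h1 : ∀ᶠ x : ℝ in atTop, ‖Real.log x‖ ≤ ε * ‖x ^ κ‖ :=
    (isLittleO_log_rpow_atTop hκ).def hε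
  have h2 : Tendsto (fun s : ℝ => 1 + s) atTop atTop := tendsto_atTop_add_const_left _ _ tendsto_id
  obtain ⟨R, hR⟩ := eventually_atTop.1
    ((h2.eventually h1).and ((eventually_ge_atTop 1).and (eventually_ge_atTop (S / a))))
  set M := max R 0
  have hM0 : 0 ≤ M := le_max_right _ _
  refine ⟨max 0 (g (a * M) + N * Real.log (1 + M) - g 0), fun s hs => ?_⟩
  by_cases hsM : s ≤ M
  · have h3 : g (a * s) ≤ g (a * M) := hg (mem_Ici.2 (by positivity)) (mem_Ici.2 (by positivity))
      (by gcongr)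
    have h4 : Real.log (1 + s) ≤ Real.log (1 + M) := Real.log_le_log (by positivity) (by gcongr)
    have h5 : g 0 ≤ g (b * s) := hg self_mem_Ici (mem_Ici.2 (by positivity)) (by positivity)
    have h6 := mul_le_mul_of_nonneg_left h4 hN
    have := le_max_right 0 (g (a * M) + N * Real.log (1 + M) - g 0)
    linarith
  · obtain ⟨h3, h4, h5⟩ := hR s ((le_max_left _ _).trans (not_le.1 hsM).le)
    have h6 : S ≤ a * s := by rwa [div_le_iff₀' ha] at h5
    have h7 := hgS _ h6
    have h8 : g (2 * (a * s)) ≤ g (b * s) := hg (mem_Ici.2 (by positivity))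
      (mem_Ici.2 (by positivity)) (by nlinarith)
    have h9 : (1 + s) ^ κ ≤ (2 / a) ^ κ * (a * s) ^ κ := by
      rw [← Real.mul_rpow (by positivity) (by positivity)]
      refine Real.rpow_le_rpow (by positivity) ?_ hκ.le
      rw [show 2 / a * (a * s) = 2 * s by field_simp]
      linarith
    have h10 : Real.log (1 + s) ≤ ε * ((2 / a) ^ κ * (a * s) ^ κ) := by
      rw [Real.norm_eq_abs, Real.norm_of_nonneg (show 0 ≤ (1 + s) ^ κ by positivity)] at h3
      exact (le_abs_self _).trans (h3.trans (by gcongr))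
    have h11 : N * Real.log (1 + s) ≤ c * (a * s) ^ κ := by
      calc N * Real.log (1 + s) ≤ (N + 1) * (ε * ((2 / a) ^ κ * (a * s) ^ κ)) := by
            have : 0 ≤ ε * ((2 / a) ^ κ * (a * s) ^ κ) := by positivity
            nlinarith [mul_le_mul_of_nonneg_left h10 hN]
        _ = c * (a * s) ^ κ := by
            simp only [ε]
            field_simp
    have := le_max_left 0 (g (a * M) + N * Real.log (1 + M) - g 0)
    linarith

/-- If s > 2, then s ≤ t + 1 forces s ≤ 2t, and doubling the scale absorbs the shift; if s ≤ 2, the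
left side is bounded. -/
theorem exists_shift_le {g : ℝ → ℝ} (hg : MonotoneOn g (Ici 0)) {a b : ℝ} (ha : 0 < a)
    (hab : 2 * a ≤ b) :
    ∃ C, ∀ s t, 0 ≤ s → 0 ≤ t → s ≤ t + 1 → g (a * s) ≤ g (b * t) + C := by
  have hb : 0 < b := by linarith
  refine ⟨max 0 (g (2 * a) - g 0), fun s t hs ht hst => ?_⟩
  by_cases h1 : s ≤ 2
  · have h3 : g (a * s) ≤ g (2 * a) := hg (mem_Ici.2 (by positivity)) (mem_Ici.2 (by positivity))
      (by nlinarith)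
    have h5 : g 0 ≤ g (b * t) := hg self_mem_Ici (mem_Ici.2 (by positivity)) (by positivity)
    have := le_max_right 0 (g (2 * a) - g 0)
    linarith
  · have h3 : g (a * s) ≤ g (b * t) := hg (mem_Ici.2 (by positivity)) (mem_Ici.2 (by positivity))
      (by nlinarith)
    have := le_max_left 0 (g (2 * a) - g 0)
    linarith

namespace WeightPair

variable (w : WeightPair)

/-- Monotonicity of α(s)/s^κ gives α(2t) ≥ 2^κ α(t) and α(t) ≥ (α(S)/S^κ) t^κ for t ≥ S.
Unboundedness allows `S` with α(S) > 0. -/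
theorem α_two_mul_sub : ∃ κ c S : ℝ, 0 < κ ∧ 0 < c ∧
    ∀ t, S ≤ t → c * t ^ κ ≤ w.α (2 * t) - w.α t := by
  obtain ⟨κ, hκ, s₀, hs₀, hmono⟩ := w.α_growth
  obtain ⟨s₁, hs₁, hα₁⟩ : ∃ s₁, 0 ≤ s₁ ∧ 0 < w.α s₁ := by
    have := w.α_unbounded
    rw [not_bddAbove_iff] at this
    obtain ⟨_, ⟨s, hs, rfl⟩, h⟩ := this 0
    exact ⟨s, hs, h⟩
  set S := max s₀ s₁
  have hS : 0 < S := lt_max_of_lt_left hs₀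
  have hαS : 0 < w.α S := hα₁.trans_le (w.α_mono hs₁ (mem_Ici.2 hS.le) (le_max_right _ _))
  have h2 : (1 : ℝ) < 2 ^ κ := Real.one_lt_rpow one_lt_two hκ
  refine ⟨κ, (2 ^ κ - 1) * (w.α S / S ^ κ), S, hκ, ?_, fun t ht => ?_⟩
  · have : 0 < (2 : ℝ) ^ κ - 1 := by linarith
    positivity
  · have ht0 : 0 < t := hS.trans_le ht
    have hst : s₀ ≤ t := (le_max_left _ _).trans ht
    have h3 : w.α S / S ^ κ ≤ w.α t / t ^ κ := hmono (mem_Ici.2 (le_max_left _ _)) hst ht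
    have h4 : w.α t / t ^ κ ≤ w.α (2 * t) / (2 * t) ^ κ :=
      hmono hst (mem_Ici.2 (by linarith)) (by linarith)
    have htκ : 0 < t ^ κ := by positivity
    rw [Real.mul_rpow (by positivity) ht0.le, div_le_div_iff₀ htκ (by positivity)] at h4
    have h5 : 2 ^ κ * w.α t ≤ w.α (2 * t) := by
      refine le_of_mul_le_mul_right ?_ htκ
      linarith
    rw [le_div_iff₀ htκ] at h3
    nlinarith

/-- The exponent is 1. Midpoint convexity on [0, 2t] gives β(2t) - β(t) ≥ β(t) - β(0), and convexity
on [0, t] bounds the latter below by t times the slope of the chord over [0, S]. -/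
theorem β_two_mul_sub : ∃ κ c S : ℝ, 0 < κ ∧ 0 < c ∧
    ∀ t, S ≤ t → c * t ^ κ ≤ w.β (2 * t) - w.β t := by
  obtain ⟨S, hS, hβS⟩ : ∃ s₁, 0 ≤ s₁ ∧ w.β 0 < w.β s₁ := by
    have := w.β_unbounded
    rw [not_bddAbove_iff] at this
    obtain ⟨_, ⟨s, hs, rfl⟩, h⟩ := this (w.β 0)
    exact ⟨s, hs, h⟩
  have hS : 0 < S := by
    rcases hS.eq_or_lt with rfl | h
    · exact absurd hβS (lt_irrefl _)
    · exact h
  refine ⟨1, (w.β S - w.β 0) / S, S, one_pos, div_pos (by linarith) hS, fun t ht => ?_⟩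
  have ht0 : 0 < t := hS.trans_le ht
  have h0 : (0 : ℝ) ∈ Ici (0 : ℝ) := self_mem_Ici
  have h1 := w.β_convex.2 h0 (mem_Ici.2 ht0.le)
    (show 0 ≤ 1 - S / t from sub_nonneg.2 (by rw [div_le_one ht0]; exact ht))
    (show 0 ≤ S / t by positivity) (by ring)
  have h2 := w.β_convex.2 h0 (show 2 * t ∈ Ici (0 : ℝ) from mem_Ici.2 (by positivity))
    (show (0 : ℝ) ≤ 1 / 2 by norm_num) (show (0 : ℝ) ≤ 1 / 2 by norm_num) (by norm_num)
  simp only [smul_eq_mul, mul_zero, zero_add, div_mul_cancel₀ _ ht0.ne'] at h1 h2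
  rw [show 1 / 2 * (2 * t) = t by ring] at h2
  have h3 : (w.β S - w.β 0) / S * t ≤ w.β t - w.β 0 := by
    rw [div_mul_eq_mul_div, div_le_iff₀ hS]
    have h4 : w.β S - w.β 0 ≤ S / t * (w.β t - w.β 0) := by linarith
    calc (w.β S - w.β 0) * t ≤ S / t * (w.β t - w.β 0) * t := by gcongr
      _ = _ := by field_simp
  rw [Real.rpow_one]
  linarith

end WeightPair

variable {k : ℕ} {U : NonemptyCone k}

/-- `i` is followed by `j` with `A` and `B` at least doubled and `W` not essentially larger. -/
structure Index.Doubles (i j : Index U) : Prop where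
  A_le : 2 * i.A ≤ j.A
  B_le : 2 * i.B ≤ j.B
  subset : j.W ⊆ closure i.W

/-- The distance to a set equals the distance to its closure, so containment up to closure suffices
throughout. -/
theorem Index.Doubles.infDist_le {i j : Index U} (h : i.Doubles j) {x y : Fin k → ℝ} :
    Metric.infDist x i.W ≤ Metric.infDist y j.W + dist x y := by
  rw [← Metric.infDist_closure (s := i.W)]
  refine (Metric.infDist_le_infDist_of_subset h.subset
    (U.nonempty.mono j.isConicNhd.subset)).trans ?_
  exact Metric.infDist_le_infDist_add_dist

theorem norm_re_le (z : Fin k → ℂ) : ‖fun j => (z j).re‖ ≤ ‖z‖ :=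
  (pi_norm_le_iff_of_nonneg (norm_nonneg _)).2 fun j =>
    (Complex.abs_re_le_norm _).trans (norm_le_pi_norm z j)

theorem norm_im_le (z : Fin k → ℂ) : ‖fun j => (z j).im‖ ≤ ‖z‖ :=
  (pi_norm_le_iff_of_nonneg (norm_nonneg _)).2 fun j =>
    (Complex.abs_im_le_norm _).trans (norm_le_pi_norm z j)

theorem norm_le_norm_re_add_norm_im (z : Fin k → ℂ) :
    ‖z‖ ≤ ‖fun j => (z j).re‖ + ‖fun j => (z j).im‖ :=
  (pi_norm_le_iff_of_nonneg (by positivity)).2 fun j =>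
    (Complex.norm_le_abs_re_add_abs_im _).trans (add_le_add
      (norm_le_pi_norm (fun j => (z j).re) j) (norm_le_pi_norm (fun j => (z j).im) j))

theorem Index.Doubles.exists_rho_shift_le (w : WeightPair) {i j : Index U} (h : i.Doubles j) :
    ∃ C, ∀ z ζ : Fin k → ℂ, ‖ζ - z‖ ≤ 1 → rho w i.W i.A i.B ζ ≤ rho w j.W j.A j.B z + C := by
  have hi := i.A_pos
  have hj := j.A_pos
  -- α enters ρ with a minus sign, so the roles of `i` and `j`, and of `z` and `ζ`, are exchanged
  -- here.
  obtain ⟨C₁, h₁⟩ := exists_shift_le w.α_mono (a := 1 / j.A) (b := 1 / i.A) (by positivity) (by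
    rw [mul_one_div, div_le_div_iff₀ hj hi]; linarith [h.A_le])
  obtain ⟨C₂, h₂⟩ := exists_shift_le w.β_mono i.B_pos h.B_le
  refine ⟨C₁ + C₂ + C₂, fun z ζ hz => ?_⟩
  have hre : ‖(fun l => (ζ l).re) - fun l => (z l).re‖ ≤ 1 :=
    (norm_re_le (ζ - z)).trans hz
  have him : ‖(fun l => (ζ l).im) - fun l => (z l).im‖ ≤ 1 :=
    (norm_im_le (ζ - z)).trans hz
  have e₁ := h₁ ‖fun l => (z l).re‖ ‖fun l => (ζ l).re‖ (norm_nonneg _) (norm_nonneg _) (by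
    have := norm_le_norm_add_norm_sub (fun l => (ζ l).re) fun l => (z l).re
    linarith)
  have e₂ := h₂ ‖fun l => (ζ l).im‖ ‖fun l => (z l).im‖ (norm_nonneg _) (norm_nonneg _) (by
    have := norm_le_norm_add_norm_sub' (fun l => (ζ l).im) fun l => (z l).im
    linarith)
  have e₃ := h₂ (Metric.infDist (fun l => (ζ l).re) i.W) (Metric.infDist (fun l => (z l).re) j.W)
    Metric.infDist_nonneg Metric.infDist_nonneg (h.infDist_le.trans (by
      rw [dist_eq_norm]; linarith))
  rw [one_div_mul_eq_div, one_div_mul_eq_div] at e₁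
  unfold rho
  linarith

/-- Since 1 + |z| ≤ (1 + |x|)(1 + |y|), the α term absorbs the logarithm in x and the term β(B|y|)
the one in y. The distance term only needs to be monotone. -/
theorem Index.Doubles.exists_rho_add_log_le (w : WeightPair) {i j : Index U} (h : i.Doubles j)
    {N : ℝ} (hN : 0 ≤ N) :
    ∃ C, ∀ z : Fin k → ℂ,
      rho w i.W i.A i.B z + N * Real.log (1 + ‖z‖) ≤ rho w j.W j.A j.B z + C := by
  have hi := i.A_pos
  have hj := j.A_pos
  obtain ⟨κ, c, S, hκ, hc, hS⟩ := w.α_two_mul_sub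
  obtain ⟨κ', c', S', hκ', hc', hS'⟩ := w.β_two_mul_sub
  obtain ⟨C₁, h₁⟩ := exists_add_log_le w.α_mono hκ hc hS (a := 1 / j.A) (b := 1 / i.A)
    (by positivity) (by rw [mul_one_div, div_le_div_iff₀ hj hi]; linarith [h.A_le]) hN
  obtain ⟨C₂, h₂⟩ := exists_add_log_le w.β_mono hκ' hc' hS' i.B_pos h.B_le hN
  refine ⟨C₁ + C₂, fun z => ?_⟩
  have e₁ := h₁ ‖fun l => (z l).re‖ (norm_nonneg _)
  have e₂ := h₂ ‖fun l => (z l).im‖ (norm_nonneg _)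
  have hB := i.B_pos
  have hB' := j.B_pos
  have hd := h.infDist_le (x := fun l => (z l).re) (y := fun l => (z l).re)
  rw [dist_self, add_zero] at hd
  have hd0 : 0 ≤ Metric.infDist (fun l => (z l).re) i.W := Metric.infDist_nonneg
  have hd1 : 0 ≤ Metric.infDist (fun l => (z l).re) j.W := Metric.infDist_nonneg
  have e₃ : w.β (i.B * Metric.infDist (fun l => (z l).re) i.W) ≤
      w.β (j.B * Metric.infDist (fun l => (z l).re) j.W) :=
    w.β_mono (mem_Ici.2 (by positivity)) (mem_Ici.2 (by positivity))
      (by have := h.B_le; gcongr; linarith)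
  have e₄ : Real.log (1 + ‖z‖) ≤
      Real.log (1 + ‖fun l => (z l).re‖) + Real.log (1 + ‖fun l => (z l).im‖) := by
    rw [← Real.log_mul (by positivity) (by positivity)]
    refine Real.log_le_log (by positivity) ?_
    have := norm_le_norm_re_add_norm_im z
    have : 0 ≤ ‖fun l => (z l).re‖ * ‖fun l => (z l).im‖ := by positivity
    linarith
  have e₅ := mul_le_mul_of_nonneg_left e₄ hN
  rw [one_div_mul_eq_div, one_div_mul_eq_div] at e₁
  unfold rho
  linarith

end

section

/-! ### Entire functions -/

variable {k : ℕ}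

theorem measurePreserving_circle_smul (c : Circle) :
    MeasurePreserving (fun v : Fin k → ℂ => (c : ℂ) • v) :=
  volume_preserving_pi fun _ => (rotation c).measurePreserving

theorem setIntegral_ball_circle_smul (f : (Fin k → ℂ) → ℂ) (c : Circle) :
    ∫ v in Metric.ball (0 : Fin k → ℂ) 1, f ((c : ℂ) • v) =
      ∫ v in Metric.ball (0 : Fin k → ℂ) 1, f v := by
  have h1 : (fun v : Fin k → ℂ => (c : ℂ) • v) ⁻¹' Metric.ball 0 1 = Metric.ball 0 1 := by
    ext v
    simp [norm_smul, Circle.norm_coe]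
  have h2 := (measurePreserving_circle_smul (k := k) c).setIntegral_preimage_emb
    ((continuous_const_smul (c : ℂ)).measurableEmbedding
      (smul_right_injective _ (Circle.coe_ne_zero c))) f (Metric.ball 0 1)
  rwa [h1] at h2

theorem circle_integral_line {f : (Fin k → ℂ) → ℂ} (hf : Differentiable ℂ f) (z v : Fin k → ℂ) :
    ∫ θ in 0..2 * Real.pi, f (z + circleMap 0 1 θ • v) = (2 * Real.pi) • f z := by
  have h1 : Differentiable ℂ fun t : ℂ => f (z + t • v) :=
    hf.comp ((differentiable_const z).add (differentiable_id.smul_const v))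
  have h2 := (h1.diffContOnCl (s := Metric.ball 0 |1|)).circleAverage
  rw [Real.circleAverage_def, zero_smul, add_zero] at h2
  rw [← h2, smul_inv_smul₀ (by positivity)]

/-- The mean value property over a unit polydisc. -/
theorem setIntegral_ball_eq {f : (Fin k → ℂ) → ℂ} (hf : Differentiable ℂ f) (z : Fin k → ℂ) :
    ∫ v in Metric.ball (0 : Fin k → ℂ) 1, f (z + v) =
      volume.real (Metric.ball (0 : Fin k → ℂ) 1) • f z := by
  set D := Metric.ball (0 : Fin k → ℂ) 1
  have hcont : Continuous fun p : ℝ × (Fin k → ℂ) => f (z + circleMap 0 1 p.1 • p.2) := by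
    have := hf.continuous
    have h := continuous_circleMap 0 1
    fun_prop
  have hint : Integrable (Function.uncurry fun (θ : ℝ) (v : Fin k → ℂ) =>
      f (z + circleMap 0 1 θ • v))
      ((volume.restrict (uIoc 0 (2 * Real.pi))).prod (volume.restrict D)) := by
    rw [Measure.prod_restrict]
    refine (hcont.continuousOn.integrableOn_compact
      ((isCompact_uIcc (a := 0) (b := 2 * Real.pi)).prod (isCompact_closedBall (0 : Fin k → ℂ) 1))).mono_set ?_
    exact prod_mono uIoc_subset_uIcc Metric.ball_subset_closedBall
  -- Integrating in θ first yields 2π f(z) for every `v`, by the mean value property on a complex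
  -- line. Integrating in `v` first yields a value independent of θ, since the polydisc is invariant
  -- under v ↦ e^{iθ} v.
  have hswap := intervalIntegral_integral_swap hint
  simp_rw [circle_integral_line hf] at hswap
  have hrot : ∀ θ : ℝ, ∫ v in D, f (z + circleMap 0 1 θ • v) = ∫ v in D, f (z + v) := fun θ => by
    have := setIntegral_ball_circle_smul (fun v => f (z + v)) (Circle.exp θ)
    simpa [circleMap] using this
  simp_rw [hrot] at hswap
  rw [intervalIntegral.integral_const, sub_zero, setIntegral_const, smul_comm] at hswap
  exact smul_right_injective ℂ (by positivity : 2 * Real.pi ≠ 0) hswap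

theorem norm_sq_le_setIntegral_ball {f : (Fin k → ℂ) → ℂ} (hf : Differentiable ℂ f)
    (z : Fin k → ℂ) : volume.real (Metric.ball (0 : Fin k → ℂ) 1) * ‖f z‖ ^ 2 ≤
      ∫ v in Metric.ball (0 : Fin k → ℂ) 1, ‖f (z + v)‖ ^ 2 := by
  have h1 := setIntegral_ball_eq (hf.pow 2) z
  have h2 := norm_integral_le_integral_norm (μ := volume.restrict (Metric.ball (0 : Fin k → ℂ) 1))
    fun v => (f ^ 2) (z + v)
  rw [h1, norm_smul, Real.norm_of_nonneg measureReal_nonneg] at h2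
  simpa using h2

/-- Cauchy's estimate for t ↦ f(z + t v) on the circle |t| = 1/‖v‖, where t v has norm 1. -/
theorem norm_fderiv_le_of_ball {f : (Fin k → ℂ) → ℂ} (hf : Differentiable ℂ f) {z : Fin k → ℂ}
    {M : ℝ} (hM : ∀ ζ ∈ Metric.closedBall z 1, ‖f ζ‖ ≤ M) : ‖fderiv ℂ f z‖ ≤ M := by
  have hM0 : 0 ≤ M := (norm_nonneg _).trans (hM z (Metric.mem_closedBall_self zero_le_one))
  refine ContinuousLinearMap.opNorm_le_bound _ hM0 fun v => ?_
  by_cases hv : v = 0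
  · simp [hv]
  have hv' : 0 < ‖v‖ := norm_pos_iff.2 hv
  have h1 : HasDerivAt (fun t : ℂ => z + t • v) v 0 := by
    simpa using ((hasDerivAt_id (0 : ℂ)).smul_const v).const_add z
  have h2 : HasDerivAt (fun t : ℂ => f (z + t • v)) (fderiv ℂ f z v) 0 := by
    refine HasFDerivAt.comp_hasDerivAt (0 : ℂ) ?_ h1
    simpa using (hf z).hasFDerivAt
  have h3 : Differentiable ℂ fun t : ℂ => f (z + t • v) :=
    hf.comp ((differentiable_const z).add (differentiable_id.smul_const v))
  have h4 := Complex.norm_deriv_le_of_forall_mem_sphere_norm_le (inv_pos.2 hv')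
    (h3.diffContOnCl (s := Metric.ball 0 ‖v‖⁻¹)) (C := M) fun t ht => hM _ ?_
  · rwa [h2.deriv, div_inv_eq_mul] at h4
  · rw [mem_sphere_zero_iff_norm] at ht
    rw [mem_closedBall_iff_norm, add_sub_cancel_left, norm_smul, ht, inv_mul_cancel₀ hv'.ne']

/-- A sequence of entire functions that is Cauchy with respect to a continuous weight converges to
an entire function. -/
theorem exists_differentiable_limit {f : ℕ → (Fin k → ℂ) → ℂ} (hf : ∀ n, Differentiable ℂ (f n))
    {M : (Fin k → ℂ) → ℝ} (hM : Continuous M)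
    (hfM : ∀ ε > 0, ∃ N, ∀ m ≥ N, ∀ n ≥ N, ∀ z, ‖f m z - f n z‖ ≤ ε * M z) :
    ∃ g : (Fin k → ℂ) → ℂ, Differentiable ℂ g ∧
      ∀ z, Tendsto (fun n => f n z) atTop (𝓝 (g z)) := by
  -- Radius 2 leaves room for a unit ball around each point of `ball x 1`, as the derivative
  -- estimate requires.
  have hloc : ∀ x : Fin k → ℂ, ∀ ε > 0, ∃ N, ∀ m ≥ N, ∀ n ≥ N, ∀ z ∈ Metric.closedBall x 2,
      ‖f m z - f n z‖ ≤ ε := by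
    intro x ε hε
    obtain ⟨C, hC⟩ := (isCompact_closedBall x 2).bddAbove_image hM.continuousOn
    have hC1 : 0 < max C 1 := lt_max_of_lt_right one_pos
    obtain ⟨N, hN⟩ := hfM (ε / max C 1) (by positivity)
    refine ⟨N, fun m hm n hn z hz => (hN m hm n hn z).trans ?_⟩
    have : M z ≤ max C 1 := (hC ⟨z, hz, rfl⟩).trans (le_max_left _ _)
    calc ε / max C 1 * M z ≤ ε / max C 1 * max C 1 := by gcongr
      _ = ε := div_mul_cancel₀ _ hC1.ne'
  have hlim : ∀ z, ∃ a, Tendsto (fun n => f n z) atTop (𝓝 a) := fun z => by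
    refine cauchySeq_tendsto_of_complete (Metric.cauchySeq_iff.2 fun ε hε => ?_)
    obtain ⟨N, hN⟩ := hloc z (ε / 2) (by positivity)
    refine ⟨N, fun m hm n hn => ?_⟩
    rw [dist_eq_norm]
    exact (hN m hm n hn z (Metric.mem_closedBall_self zero_le_two)).trans_lt (half_lt_self hε)
  choose g hg using hlim
  have hder : ∀ x : Fin k → ℂ,
      UniformCauchySeqOn (fun n => fderiv ℂ (f n)) atTop (Metric.ball x 1) := fun x => by
    refine Metric.uniformCauchySeqOn_iff.2 fun ε hε => ?_
    obtain ⟨N, hN⟩ := hloc x (ε / 2) (by positivity)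
    refine ⟨N, fun m hm n hn z hz => ?_⟩
    rw [dist_eq_norm, ← fderiv_sub (hf m z) (hf n z)]
    refine (norm_fderiv_le_of_ball ((hf m).sub (hf n)) (M := ε / 2) fun ζ hζ => ?_).trans_lt
      (half_lt_self hε)
    refine hN m hm n hn ζ (Metric.mem_closedBall.2 ?_)
    have h1 := dist_triangle ζ z x
    have h2 := Metric.mem_closedBall.1 hζ
    have h3 := Metric.mem_ball.1 hz
    linarith
  have hder' : ∀ x, ∃ a, Tendsto (fun n => fderiv ℂ (f n) x) atTop (𝓝 a) := fun x =>
    cauchySeq_tendsto_of_complete ((hder x).cauchySeq (Metric.mem_ball_self one_pos))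
  choose g' hg' using hder'
  refine ⟨g, fun x => ?_, hg⟩
  exact (hasFDerivAt_of_tendstoUniformlyOn Metric.isOpen_ball
    ((hder x).tendstoUniformlyOn_of_tendsto fun y _ => hg' y)
    (fun n y _ => (hf n y).hasFDerivAt) (fun y _ => hg y)
    (Metric.mem_ball_self one_pos)).differentiableAt

end

section

variable {k : ℕ}

/-! ### The step spaces -/

theorem SupStep.norm_apply_le {w : WeightPair} {W : Set (Fin k → ℝ)} {A B : ℝ}
    (f : SupStep w W A B) (z : Fin k → ℂ) : ‖f.1 z‖ ≤ ‖f‖ * Real.exp (rho w W A B z) := by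
  have h1 : ‖f.1 z‖ * Real.exp (-rho w W A B z) ≤ ‖f‖ := le_ciSup f.2.2 z
  rwa [Real.exp_neg, ← div_eq_mul_inv, div_le_iff₀ (Real.exp_pos _)] at h1

theorem SupStep.norm_le {w : WeightPair} {W : Set (Fin k → ℝ)} {A B : ℝ}
    (f : SupStep w W A B) {C : ℝ} (h : ∀ z, ‖f.1 z‖ ≤ C * Real.exp (rho w W A B z)) : ‖f‖ ≤ C := by
  refine ciSup_le fun z => ?_
  rw [Real.exp_neg, ← div_eq_mul_inv, div_le_iff₀ (Real.exp_pos _)]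
  exact h z

theorem mem_supSubmodule {w : WeightPair} {W : Set (Fin k → ℝ)} {A B : ℝ} {f : (Fin k → ℂ) → ℂ}
    (hf : Differentiable ℂ f) {C : ℝ} (h : ∀ z, ‖f z‖ ≤ C * Real.exp (rho w W A B z)) :
    f ∈ supSubmodule w W A B := by
  refine ⟨hf, C, ?_⟩
  rintro _ ⟨z, rfl⟩
  dsimp only
  rw [Real.exp_neg, ← div_eq_mul_inv, div_le_iff₀ (Real.exp_pos _)]
  exact h z

theorem norm_mul_exp_sq (a : ℂ) (r : ℝ) :
    ‖a * (Real.exp (-r) : ℂ)‖ ^ 2 = ‖a‖ ^ 2 * Real.exp (-2 * r) := by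
  rw [norm_mul, mul_pow, Complex.norm_real, Real.norm_of_nonneg (Real.exp_pos _).le,
    ← Real.exp_nat_mul]
  congr 2
  push_cast
  ring

namespace HilbertStep

variable {w : WeightPair} {W : Set (Fin k → ℝ)} {A B : ℝ}

theorem norm_toL2 (f : HilbertStep w W A B) : ‖toL2 w W A B f‖ = ‖f‖ :=
  (toL2_norm w W A B f).trans (norm_def w W A B f).symm

instance : InnerProductSpace ℂ (HilbertStep w W A B) where
  inner f g := inner ℂ (toL2 w W A B f) (toL2 w W A B g)
  norm_sq_eq_re_inner f := by
    rw [← norm_toL2]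
    exact norm_sq_eq_re_inner _
  conj_inner_symm f g := inner_conj_symm _ _
  add_left f g h := by rw [map_add, inner_add_left]
  smul_left f g c := by rw [map_smul, inner_smul_left]

theorem integrable (f : HilbertStep w W A B) :
    Integrable fun z => ‖f.1 z‖ ^ 2 * Real.exp (-2 * rho w W A B z) := by
  have h1 := (memLp_two_iff_integrable_sq_norm f.2.2.1).1 f.2.2
  simpa only [norm_mul_exp_sq] using h1

theorem norm_sq (f : HilbertStep w W A B) :
    ‖f‖ ^ 2 = ∫ z, ‖f.1 z‖ ^ 2 * Real.exp (-2 * rho w W A B z) := by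
  rw [norm_def, Real.sq_sqrt]
  exact integral_nonneg fun z => by positivity

/-- Evaluation at a point. -/
def eval (z : Fin k → ℂ) : HilbertStep w W A B →ₗ[ℂ] ℂ where
  toFun f := f.1 z
  map_add' _ _ := rfl
  map_smul' _ _ := rfl

end HilbertStep

variable {U : NonemptyCone k} {w : WeightPair}

theorem mem_hilbertSubmodule (i : Index U) {f : (Fin k → ℂ) → ℂ} (hf : Differentiable ℂ f)
    (h : Integrable fun z => ‖f z‖ ^ 2 * Real.exp (-2 * rho w i.W i.A i.B z)) :
    f ∈ hilbertSubmodule w i.W i.A i.B := by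
  refine ⟨hf, (memLp_two_iff_integrable_sq_norm ?_).2 ?_⟩
  · have h1 := continuous_rho w U i
    have h2 := hf.continuous
    exact Continuous.aestronglyMeasurable (by fun_prop)
  · simpa only [norm_mul_exp_sq] using h

/-! ### Inclusions between steps and the Hilbert–Schmidt property -/

namespace Index.Doubles

variable {i j l : Index U}

theorem integrable_exp (w : WeightPair) (h : i.Doubles j) : Integrable fun z : Fin k → ℂ =>
    Real.exp (2 * (rho w i.W i.A i.B z - rho w j.W j.A j.B z)) := by
  -- An exponent above the real dimension makes (1 + ‖z‖)^(-r) integrable. The gain needed in ρ is r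
  -- / 2 because the difference of weights is doubled.
  set r : ℝ := Module.finrank ℝ (Fin k → ℂ) + 1
  have hr : 0 < r := by positivity
  obtain ⟨C, hC⟩ := h.exists_rho_add_log_le w (N := r / 2) (by positivity)
  have h1 : Integrable fun z : Fin k → ℂ => Real.exp (2 * C) * (1 + ‖z‖) ^ (-r) :=
    (integrable_one_add_norm (lt_add_one _)).const_mul _
  refine h1.mono' ?_ (Eventually.of_forall fun z => ?_)
  · have h2 := continuous_rho w U i
    have h3 := continuous_rho w U j
    exact Continuous.aestronglyMeasurable (by fun_prop)
  · rw [Real.norm_of_nonneg (Real.exp_pos _).le, Real.rpow_def_of_pos (by positivity),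
      ← Real.exp_add]
    refine Real.exp_le_exp.2 ?_
    linarith [hC z]

theorem norm_sup_sq_le (f : SupStep w i.W i.A i.B) (z : Fin k → ℂ) :
    ‖f.1 z‖ ^ 2 * Real.exp (-2 * rho w j.W j.A j.B z) ≤
      Real.exp (2 * (rho w i.W i.A i.B z - rho w j.W j.A j.B z)) * ‖f‖ ^ 2 := by
  calc ‖f.1 z‖ ^ 2 * Real.exp (-2 * rho w j.W j.A j.B z)
      ≤ (‖f‖ * Real.exp (rho w i.W i.A i.B z)) ^ 2 * Real.exp (-2 * rho w j.W j.A j.B z) := by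
        gcongr; exact f.norm_apply_le z
    _ = _ := by
        rw [mul_pow, ← Real.exp_nat_mul, mul_assoc, ← Real.exp_add, mul_comm]
        congr 2
        push_cast
        ring

theorem integrable_sup (h : i.Doubles j) (f : SupStep w i.W i.A i.B) :
    Integrable fun z => ‖f.1 z‖ ^ 2 * Real.exp (-2 * rho w j.W j.A j.B z) := by
  refine ((h.integrable_exp w).mul_const (‖f‖ ^ 2)).mono' ?_ (Eventually.of_forall fun z => ?_)
  · have h2 := continuous_rho w U j
    have h3 := f.2.1.continuous
    exact Continuous.aestronglyMeasurable (by fun_prop)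
  · rw [Real.norm_of_nonneg (by positivity)]
    exact norm_sup_sq_le f z

theorem norm_sup_le (h : i.Doubles j) (f : SupStep w i.W i.A i.B) (g : HilbertStep w j.W j.A j.B)
    (hfg : g.1 = f.1) : ‖g‖ ≤ Real.sqrt (∫ z : Fin k → ℂ,
      Real.exp (2 * (rho w i.W i.A i.B z - rho w j.W j.A j.B z))) * ‖f‖ := by
  refine le_of_sq_le_sq ?_ (by positivity)
  rw [g.norm_sq, hfg, mul_pow, Real.sq_sqrt (integral_nonneg fun z => (Real.exp_pos _).le),
    ← integral_mul_const]
  refine integral_mono (h.integrable_sup f) ((h.integrable_exp w).mul_const _) fun z => ?_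
  exact norm_sup_sq_le f z

/-- The continuous inclusion of a space with supremum norm into a space with Hilbert norm. -/
def supToHilbert (w : WeightPair) (h : i.Doubles j) :
    SupStep w i.W i.A i.B →L[ℂ] HilbertStep w j.W j.A j.B :=
  LinearMap.mkContinuous
    { toFun := fun f => ⟨f.1, mem_hilbertSubmodule j f.2.1 (h.integrable_sup f)⟩
      map_add' := fun _ _ => rfl
      map_smul' := fun _ _ => rfl } _ fun f => h.norm_sup_le f _ rfl

theorem supToHilbert_val (h : i.Doubles j) (f : SupStep w i.W i.A i.B) :
    (h.supToHilbert w f).1 = f.1 := rfl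

/-- |f(z)|² is at most the mean of |f|² over the unit polydisc around z, where ρ_i ≤ ρ_j(z) + C lets
the weight be inserted. -/
theorem exists_norm_apply_le (w : WeightPair) (h : i.Doubles j) :
    ∃ C, ∀ (f : HilbertStep w i.W i.A i.B) (z : Fin k → ℂ),
      ‖f.1 z‖ ≤ C * ‖f‖ * Real.exp (rho w j.W j.A j.B z) := by
  obtain ⟨C, hC⟩ := h.exists_rho_shift_le w
  set m := volume.real (Metric.ball (0 : Fin k → ℂ) 1)
  have hm : 0 < m := ENNReal.toReal_pos (Metric.measure_ball_pos _ _ one_pos).ne' measure_ball_lt_top.ne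
  refine ⟨Real.sqrt m⁻¹ * Real.exp C, fun f z => ?_⟩
  have h1 := norm_sq_le_setIntegral_ball f.2.1 z
  have hint : Integrable fun v =>
      Real.exp (2 * (rho w j.W j.A j.B z + C)) *
      (‖f.1 (z + v)‖ ^ 2 * Real.exp (-2 * rho w i.W i.A i.B (z + v))) :=
    (f.integrable.comp_add_left z).const_mul _
  have h2 : ∫ v in Metric.ball (0 : Fin k → ℂ) 1, ‖f.1 (z + v)‖ ^ 2 ≤
      Real.exp (2 * (rho w j.W j.A j.B z + C)) * ‖f‖ ^ 2 := by
    calc ∫ v in Metric.ball (0 : Fin k → ℂ) 1, ‖f.1 (z + v)‖ ^ 2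
        ≤ ∫ v in Metric.ball (0 : Fin k → ℂ) 1, Real.exp (2 * (rho w j.W j.A j.B z + C)) *
          (‖f.1 (z + v)‖ ^ 2 * Real.exp (-2 * rho w i.W i.A i.B (z + v))) := by
          refine setIntegral_mono_on ?_ hint.integrableOn measurableSet_ball fun v hv => ?_
          · have hf := f.2.1.continuous
            exact ((by fun_prop : Continuous fun v => ‖f.1 (z + v)‖ ^ 2).continuousOn
              |>.integrableOn_compact (isCompact_closedBall (0 : Fin k → ℂ) 1)).mono_set
                Metric.ball_subset_closedBall
          · rw [mul_left_comm, ← Real.exp_add]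
            refine le_mul_of_one_le_right (by positivity) (Real.one_le_exp ?_)
            have := hC z (z + v) (by simpa using (mem_ball_zero_iff.1 hv).le)
            linarith
      _ ≤ ∫ v, Real.exp (2 * (rho w j.W j.A j.B z + C)) *
          (‖f.1 (z + v)‖ ^ 2 * Real.exp (-2 * rho w i.W i.A i.B (z + v))) :=
          setIntegral_le_integral hint (Eventually.of_forall fun v => by positivity)
      _ = _ := by
          rw [integral_const_mul, f.norm_sq, integral_add_left_eq_self
            fun v => ‖f.1 v‖ ^ 2 * Real.exp (-2 * rho w i.W i.A i.B v)]
  have hexp : ∀ a : ℝ, Real.exp (2 * a) = Real.exp a ^ 2 := fun a => by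
    rw [← Real.exp_nat_mul]; push_cast; rfl
  refine le_of_sq_le_sq ?_ (by positivity)
  calc ‖f.1 z‖ ^ 2 = m⁻¹ * (m * ‖f.1 z‖ ^ 2) := by field_simp
    _ ≤ m⁻¹ * (Real.exp (2 * (rho w j.W j.A j.B z + C)) * ‖f‖ ^ 2) := by
        exact mul_le_mul_of_nonneg_left (h1.trans h2) (inv_nonneg.2 hm.le)
    _ = _ := by
        rw [hexp, Real.exp_add, mul_pow, mul_pow, mul_pow, mul_pow, Real.sq_sqrt (by positivity)]
        ring

/-- The continuous inclusion of a space with Hilbert norm into a space with supremum norm. -/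
def hilbertToSup (w : WeightPair) (h : i.Doubles j) :
    HilbertStep w i.W i.A i.B →L[ℂ] SupStep w j.W j.A j.B :=
  LinearMap.mkContinuousOfExistsBound
    { toFun := fun f => ⟨f.1, mem_supSubmodule f.2.1 ((h.exists_norm_apply_le w).choose_spec f)⟩
      map_add' := fun _ _ => rfl
      map_smul' := fun _ _ => rfl }
    ⟨_, fun f => SupStep.norm_le _ ((h.exists_norm_apply_le w).choose_spec f)⟩

theorem hilbertToSup_val (h : i.Doubles j) (f : HilbertStep w i.W i.A i.B) :
    (h.hilbertToSup w f).1 = f.1 := rfl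

/-- A reproducing kernel argument. With S the sum on the left, the test function g = ∑ conj(e(z)) e
satisfies g(z) = S and ‖g‖² = S, so boundedness of evaluation gives S ≤ C √S exp ρ_j(z). -/
theorem sum_norm_sq_le (h : i.Doubles j) (s : Finset (HilbertStep w i.W i.A i.B))
    (hs : Orthonormal ℂ ((↑) : s → HilbertStep w i.W i.A i.B)) (z : Fin k → ℂ) :
    ∑ e ∈ s, ‖e.1 z‖ ^ 2 ≤ ‖h.hilbertToSup w‖ ^ 2 * Real.exp (2 * rho w j.W j.A j.B z) := by
  set S := ∑ e ∈ s, ‖e.1 z‖ ^ 2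
  have hS : 0 ≤ S := Finset.sum_nonneg fun _ _ => by positivity
  set g : HilbertStep w i.W i.A i.B := ∑ e : s, (starRingEnd ℂ) (e.1.1 z) • e.1
  have hgz : g.1 z = (S : ℂ) := by
    have h1 : g.1 z = ∑ e : s, (starRingEnd ℂ) (e.1.1 z) * e.1.1 z := by
      change HilbertStep.eval z g = _
      simp only [g, map_sum, map_smul, smul_eq_mul]
      rfl
    simp only [h1, Complex.conj_mul', S, Complex.ofReal_sum, Complex.ofReal_pow]
    exact Finset.sum_coe_sort s fun e => (‖e.1 z‖ : ℂ) ^ 2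
  have hg : ‖g‖ ^ 2 = S := by
    have h1 := hs.inner_sum (fun e : s => (starRingEnd ℂ) (e.1.1 z))
      (fun e : s => (starRingEnd ℂ) (e.1.1 z)) Finset.univ
    simp only [Complex.conj_conj, Complex.mul_conj'] at h1
    have h2 : inner ℂ g g = ((‖g‖ : ℂ)) ^ 2 := inner_self_eq_norm_sq_to_K g
    have h3 := (h2.symm.trans h1).trans
      (Finset.sum_coe_sort s fun e => (‖e.1 z‖ : ℂ) ^ 2)
    simp only [S]
    exact_mod_cast h3
  have h1 := (h.hilbertToSup w g).norm_apply_le z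
  have h2 := (h.hilbertToSup w).le_opNorm g
  have h3 : S ≤ ‖h.hilbertToSup w‖ * ‖g‖ * Real.exp (rho w j.W j.A j.B z) := by
    have h4 : (h.hilbertToSup w g).1 z = (S : ℂ) := hgz
    rw [h4, Complex.norm_real, Real.norm_of_nonneg hS] at h1
    exact h1.trans (by gcongr)
  rw [two_mul, Real.exp_add]
  rcases hS.eq_or_lt with h0 | h0
  · rw [← h0]
    positivity
  · refine le_of_mul_le_mul_right ?_ h0
    calc S * S ≤ (‖h.hilbertToSup w‖ * ‖g‖ * Real.exp (rho w j.W j.A j.B z)) *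
          (‖h.hilbertToSup w‖ * ‖g‖ * Real.exp (rho w j.W j.A j.B z)) :=
          mul_self_le_mul_self hS h3
      _ = _ := by rw [← hg]; ring

/-- The pointwise bound of `sum_norm_sq_le` does not depend on the orthonormal system, and it is
integrable against exp(-2ρ_l). -/
theorem isHilbertSchmidt (w : WeightPair) (h : i.Doubles j) (h' : j.Doubles l) :
    IsHilbertSchmidt ((h'.supToHilbert w).comp (h.hilbertToSup w)) := by
  refine ⟨∫ z : Fin k → ℂ, ‖h.hilbertToSup w‖ ^ 2 *
    Real.exp (2 * (rho w j.W j.A j.B z - rho w l.W l.A l.B z)), fun s hs => ?_⟩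
  have h1 : ∀ e ∈ s, Integrable fun z =>
      ‖e.1 z‖ ^ 2 * Real.exp (-2 * rho w l.W l.A l.B z) := fun e _ =>
    ((h'.supToHilbert w).comp (h.hilbertToSup w) e).integrable
  have h2 : ∑ e ∈ s, ‖(h'.supToHilbert w).comp (h.hilbertToSup w) e‖ ^ 2 =
      ∫ z, ∑ e ∈ s, ‖e.1 z‖ ^ 2 * Real.exp (-2 * rho w l.W l.A l.B z) := by
    rw [integral_finsetSum s h1]
    exact Finset.sum_congr rfl fun e _ => HilbertStep.norm_sq _
  rw [h2]
  refine integral_mono (integrable_finsetSum s h1) ((h'.integrable_exp w).const_mul _)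
    fun z => ?_
  dsimp only
  rw [← Finset.sum_mul]
  calc (∑ e ∈ s, ‖e.1 z‖ ^ 2) * Real.exp (-2 * rho w l.W l.A l.B z)
      ≤ ‖h.hilbertToSup w‖ ^ 2 * Real.exp (2 * rho w j.W j.A j.B z) *
        Real.exp (-2 * rho w l.W l.A l.B z) := by
        gcongr; exact h.sum_norm_sq_le s hs z
    _ = _ := by
        rw [mul_assoc, ← Real.exp_add]
        congr 2
        ring

end Index.Doubles

/-- The index with `A` and `B` doubled. -/
def Index.double (i : Index U) : Index U where
  A := 2 * i.A
  B := 2 * i.B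
  W := i.W
  A_pos := mul_pos two_pos i.A_pos
  B_pos := mul_pos two_pos i.B_pos
  isConicNhd := i.isConicNhd

theorem Index.doubles_double (i : Index U) : i.Doubles i.double :=
  ⟨le_rfl, le_rfl, subset_closure⟩

/-- The L² limit must come from an entire function. The Hilbert norm controls a weighted sup norm
for the doubled index, so a Cauchy sequence converges pointwise to an entire `g`; an almost
everywhere convergent subsequence identifies the L² limit with g exp(-ρ). -/
instance HilbertStep.completeSpace (i : Index U) : CompleteSpace (HilbertStep w i.W i.A i.B) := by
  refine Metric.complete_of_cauchySeq_tendsto fun f hf => ?_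
  obtain ⟨C, hC⟩ := i.doubles_double.exists_norm_apply_le w
  set M : (Fin k → ℂ) → ℝ := fun z =>
    |C| * Real.exp (rho w i.double.W i.double.A i.double.B z)
  have hM : Continuous M := by
    have := continuous_rho w U i.double
    fun_prop
  obtain ⟨g, hg, hfg⟩ := exists_differentiable_limit (f := fun n => (f n).1) (fun n => (f n).2.1)
    hM fun ε hε => by
      obtain ⟨N, hN⟩ := Metric.cauchySeq_iff.1 hf ε hε
      refine ⟨N, fun m hm n hn z => ?_⟩
      have h1 := hN m hm n hn
      rw [dist_eq_norm] at h1
      calc ‖(f m).1 z - (f n).1 z‖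
          ≤ C * ‖f m - f n‖ * Real.exp (rho w i.double.W i.double.A i.double.B z) :=
            hC (f m - f n) z
        _ ≤ |C| * ε * Real.exp (rho w i.double.W i.double.A i.double.B z) := by
            gcongr
            exact le_abs_self C
        _ = ε * M z := by ring
  have hcauchy : CauchySeq fun n => toL2 w i.W i.A i.B (f n) := by
    refine Metric.cauchySeq_iff.2 fun ε hε => ?_
    obtain ⟨N, hN⟩ := Metric.cauchySeq_iff.1 hf ε hε
    refine ⟨N, fun m hm n hn => ?_⟩
    rw [dist_eq_norm, ← map_sub, norm_toL2, ← dist_eq_norm]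
    exact hN m hm n hn
  obtain ⟨G, hG⟩ := cauchySeq_tendsto_of_complete hcauchy
  obtain ⟨ns, hns, hae⟩ := (tendstoInMeasure_of_tendsto_Lp hG).exists_seq_tendsto_ae
  have hgG : G =ᵐ[volume] fun z => g z * (Real.exp (-rho w i.W i.A i.B z) : ℂ) := by
    have h1 : ∀ᵐ z, ∀ n, toL2 w i.W i.A i.B (f n) z =
        (f n).1 z * (Real.exp (-rho w i.W i.A i.B z) : ℂ) :=
      ae_all_iff.2 fun n => (f n).2.2.coeFn_toLp
    filter_upwards [h1, hae] with z hz hz'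
    refine tendsto_nhds_unique hz' ?_
    simp only [hz]
    exact ((hfg z).comp hns.tendsto_atTop).mul_const _
  have hgL : MemLp (fun z => g z * (Real.exp (-rho w i.W i.A i.B z) : ℂ)) 2 volume :=
    (memLp_congr_ae hgG).1 (Lp.memLp G)
  let F : HilbertStep w i.W i.A i.B :=
    (⟨g, ⟨hg, hgL⟩⟩ : ↥(hilbertSubmodule w i.W i.A i.B))
  have h2 : toL2 w i.W i.A i.B F = G := Lp.ext (hgL.coeFn_toLp.trans hgG.symm)
  refine ⟨F, tendsto_iff_norm_sub_tendsto_zero.2 ?_⟩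
  refine (tendsto_iff_norm_sub_tendsto_zero.1 hG).congr fun n => ?_
  rw [← h2, ← map_sub, norm_toL2]

theorem Index.Doubles.hasNuclearExpansion (w : WeightPair) {a b c d e : Index U}
    (h₁ : a.Doubles b) (h₂ : b.Doubles c) (h₃ : c.Doubles d) (h₄ : d.Doubles e) :
    HasNuclearExpansion (((h₄.supToHilbert w).comp (h₃.hilbertToSup w)).comp
      ((h₂.supToHilbert w).comp (h₁.hilbertToSup w))) :=
  (h₃.isHilbertSchmidt w h₄).hasNuclearExpansion_comp (h₁.isHilbertSchmidt w h₂)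

end

section

variable {k : ℕ} (w : WeightPair) (U : NonemptyCone k)

/-! ### The inductive limits -/

instance : IsTopologicalAddGroup (SupSpace w U) := isTopologicalAddGroup_inductiveLimit _

instance : ContinuousSMul ℂ (SupSpace w U) := continuousSMul_inductiveLimit _

instance : LocallyConvexSpace ℝ (SupSpace w U) := locallyConvexSpace_inductiveLimit _

instance : IsTopologicalAddGroup (HilbertSpaceUnion w U) := isTopologicalAddGroup_inductiveLimit _

instance : ContinuousSMul ℂ (HilbertSpaceUnion w U) := continuousSMul_inductiveLimit _

instance : LocallyConvexSpace ℝ (HilbertSpaceUnion w U) := locallyConvexSpace_inductiveLimit _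

theorem continuous_supIncl (i : Index U) : Continuous (supIncl w U i) :=
  continuous_inductiveLimit_map (supIncl w U) i

theorem continuous_hilbertIncl (i : Index U) : Continuous (hilbertIncl w U i) :=
  continuous_inductiveLimit_map (hilbertIncl w U) i

theorem supUnion_eq_hilbertUnion : supUnion w U = hilbertUnion w U := by
  refine le_antisymm (fun f hf => ?_) fun f hf => ?_
  · obtain ⟨i, hi⟩ := mem_iUnion.1 hf
    exact mem_iUnion.2 ⟨i.double, (i.doubles_double.supToHilbert w ⟨f, hi⟩).2⟩
  · obtain ⟨i, hi⟩ := mem_iUnion.1 hf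
    exact mem_iUnion.2 ⟨i.double, (i.doubles_double.hilbertToSup w ⟨f, hi⟩).2⟩

theorem supIncl_val (i : Index U) (f : SupStep w i.W i.A i.B) : (supIncl w U i f).1 = f.1 := rfl

theorem hilbertIncl_val (i : Index U) (f : HilbertStep w i.W i.A i.B) :
    (hilbertIncl w U i f).1 = f.1 := rfl

/-- The identity map between the two unions, as a linear equivalence. -/
def supLinearEquivHilbert : SupSpace w U ≃ₗ[ℂ] HilbertSpaceUnion w U :=
  LinearEquiv.ofEq _ _ (supUnion_eq_hilbertUnion w U)

/-- The identity map between the two unions, as a topological isomorphism. -/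
def supEquivHilbert : SupSpace w U ≃L[ℂ] HilbertSpaceUnion w U where
  toLinearEquiv := supLinearEquivHilbert w U
  continuous_toFun := by
    refine continuous_of_inductiveLimit (supIncl w U) (supLinearEquivHilbert w U).toLinearMap
      fun i => ?_
    refine ((continuous_hilbertIncl w U i.double).comp
      (i.doubles_double.supToHilbert w).continuous).congr fun f => Subtype.ext ?_
    exact (hilbertIncl_val w U _ _).trans (i.doubles_double.supToHilbert_val f)
  continuous_invFun := by
    refine continuous_of_inductiveLimit (hilbertIncl w U)
      (supLinearEquivHilbert w U).symm.toLinearMap fun i => ?_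
    refine ((continuous_supIncl w U i.double).comp
      (i.doubles_double.hilbertToSup w).continuous).congr fun f => Subtype.ext ?_
    exact (supIncl_val w U _ _).trans (i.doubles_double.hilbertToSup_val f)

/-- Evaluation at a point. -/
def SupSpace.eval (z : Fin k → ℂ) : SupSpace w U →ₗ[ℂ] ℂ where
  toFun f := f.1 z
  map_add' _ _ := rfl
  map_smul' _ _ := rfl

/-- Evaluations separate points, so their continuity makes the limit Hausdorff. -/
theorem SupSpace.continuous_eval (z : Fin k → ℂ) : Continuous (SupSpace.eval w U z) := by
  refine continuous_of_inductiveLimit_normed (supIncl w U) _ fun i => ?_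
  refine (LinearMap.mkContinuous ((SupSpace.eval w U z).comp (supIncl w U i))
    (Real.exp (rho w i.W i.A i.B z)) fun f => ?_).continuous
  rw [mul_comm]
  exact f.norm_apply_le z

instance : T2Space (SupSpace w U) :=
  T2Space.of_injective_continuous (f := fun f : SupSpace w U => f.1)
    (fun _ _ h => Subtype.ext h) (continuous_pi fun z => SupSpace.continuous_eval w U z)

/-- The continuous inclusion of a space with Hilbert norm into the union. -/
def hilbertInclSup (i : Index U) : HilbertStep w i.W i.A i.B →L[ℂ] SupSpace w U :=
  (⟨supIncl w U i.double, continuous_supIncl w U i.double⟩ :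
    SupStep w i.double.W i.double.A i.double.B →L[ℂ] SupSpace w U).comp
    (i.doubles_double.hilbertToSup w)

theorem hilbertInclSup_val (i : Index U) (f : HilbertStep w i.W i.A i.B) :
    (hilbertInclSup w U i f).1 = f.1 :=
  (supIncl_val w U _ _).trans (i.doubles_double.hilbertToSup_val f)

variable {U}

/-- Interleaving again: each sup-norm step maps into some chosen Hilbert step, and each of these
into the sup-norm step of its double. -/
theorem topology_eq_of_cofinal {s : ℕ → Index U} (hs : ∀ i : Index U, ∃ n, i.Doubles (s n)) :
    (inferInstance : TopologicalSpace (SupSpace w U)) = inductiveLimitTopology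
      (fun n => HilbertStep w (s n).W (s n).A (s n).B)
      fun n => (hilbertInclSup w U (s n)).toLinearMap := by
  refine le_antisymm (inductiveLimitTopology_le _ _ fun i => ?_)
    (inductiveLimitTopology_le _ _ fun n => ?_)
  · obtain ⟨n, hn⟩ := hs i
    exact ⟨n, hn.supToHilbert w, (hn.supToHilbert w).continuous, fun f => Subtype.ext
      ((hilbertInclSup_val w U _ _).trans (hn.supToHilbert_val f))⟩
  · exact ⟨(s n).double, (s n).doubles_double.hilbertToSup w,
      ((s n).doubles_double.hilbertToSup w).continuous, fun f => Subtype.ext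
        (((supIncl_val w U _ _).trans ((s n).doubles_double.hilbertToSup_val f)).trans
          (hilbertInclSup_val w U _ f).symm)⟩

theorem exists_hilbertInclSup_eq {s : ℕ → Index U} (hs : ∀ i : Index U, ∃ n, i.Doubles (s n))
    (f : SupSpace w U) : ∃ n x, hilbertInclSup w U (s n) x = f := by
  obtain ⟨i, hi⟩ := mem_iUnion.1 f.2
  obtain ⟨n, hn⟩ := hs i
  exact ⟨n, hn.supToHilbert w ⟨f.1, hi⟩, Subtype.ext
    ((hilbertInclSup_val w U _ _).trans (hn.supToHilbert_val _))⟩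

/-- The inclusion of step spaces through three intermediate steps. -/
def hilbertLink {i j : Index U} (h : i.double.double.double.Doubles j) :
    HilbertStep w i.W i.A i.B →L[ℂ] HilbertStep w j.W j.A j.B :=
  ((h.supToHilbert w).comp (i.double.double.doubles_double.hilbertToSup w)).comp
    ((i.double.doubles_double.supToHilbert w).comp (i.doubles_double.hilbertToSup w))

theorem hilbertLink_val {i j : Index U} (h : i.double.double.double.Doubles j)
    (f : HilbertStep w i.W i.A i.B) : (hilbertLink w h f).1 = f.1 := by
  refine (h.supToHilbert_val _).trans ?_
  refine (i.double.double.doubles_double.hilbertToSup_val _).trans ?_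
  exact (i.double.doubles_double.supToHilbert_val _).trans (i.doubles_double.hilbertToSup_val f)

theorem hilbertInclSup_hilbertLink {i j : Index U} (h : i.double.double.double.Doubles j)
    (f : HilbertStep w i.W i.A i.B) :
    hilbertInclSup w U j (hilbertLink w h f) = hilbertInclSup w U i f :=
  Subtype.ext ((hilbertInclSup_val w U _ _).trans
    ((hilbertLink_val w h f).trans (hilbertInclSup_val w U _ f).symm))

theorem injective_hilbertLink {i j : Index U} (h : i.double.double.double.Doubles j) :
    Function.Injective (hilbertLink w h) := fun f g hfg => Subtype.ext <| by
  rw [← hilbertLink_val w h f, ← hilbertLink_val w h g, hfg]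

theorem injective_hilbertInclSup (i : Index U) : Function.Injective (hilbertInclSup w U i) :=
  fun f g hfg => Subtype.ext <| by
    rw [← hilbertInclSup_val w U i f, ← hilbertInclSup_val w U i g, hfg]

theorem hasNuclearExpansion_hilbertLink {i j : Index U} (h : i.double.double.double.Doubles j) :
    HasNuclearExpansion (hilbertLink w h) :=
  i.doubles_double.hasNuclearExpansion w i.double.doubles_double i.double.double.doubles_double h

theorem isDFSSpace_of_cofinal {s : ℕ → Index U}
    (hs : ∀ n, (s n).double.double.double.Doubles (s (n + 1)))
    (hs' : ∀ i : Index U, ∃ n, i.Doubles (s n)) : IsDFSSpace (SupSpace w U) :=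
  ⟨fun n => HilbertStep w (s n).W (s n).A (s n).B, inferInstance, inferInstance, inferInstance,
    fun n => hilbertLink w (hs n), fun n => (hilbertInclSup w U (s n)).toLinearMap,
    inferInstance, inferInstance, fun _ => NormedSpace.toLocallyConvexSpace, inferInstance,
    fun n => injective_hilbertLink w (hs n), fun n => (hasNuclearExpansion_hilbertLink w (hs n)).isCompactOperator,
    fun n => hilbertInclSup_hilbertLink w (hs n), fun n => injective_hilbertInclSup w (s n),
    exists_hilbertInclSup_eq w hs', topology_eq_of_cofinal w hs'⟩

theorem isNuclearSpace_of_cofinal {s : ℕ → Index U}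
    (hs : ∀ n, (s n).double.double.double.Doubles (s (n + 1)))
    (hs' : ∀ i : Index U, ∃ n, i.Doubles (s n)) : IsNuclearSpace (SupSpace w U) where
  isTopologicalAddGroup := inferInstance
  continuousSMul := inferInstance
  locallyConvex := inferInstance
  t2 := inferInstance
  nuclear _ _ _ _ u :=
    isNuclearMap_of_inductiveLimit (fun n => (hilbertInclSup w U (s n)).toLinearMap)
      (topology_eq_of_cofinal w hs') (exists_hilbertInclSup_eq w hs') u fun n =>
      ⟨_, (hasNuclearExpansion_hilbertLink w (hs n)).comp_left
        (u.comp (hilbertInclSup w U (s (n + 1)))), fun x =>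
          congrArg u (hilbertInclSup_hilbertLink w (hs n) x)⟩

/-! ### Countably generated systems of conic neighborhoods -/

theorem IsConicNhd.inter {V W : Set (Fin k → ℝ)} (hV : IsConicNhd V U.carrier)
    (hW : IsConicNhd W U.carrier) : IsConicNhd (V ∩ W) U.carrier :=
  Index.isConicNhd (Index.sup ⟨1, 1, V, one_pos, one_pos, hV⟩ ⟨1, 1, W, one_pos, one_pos, hW⟩)

/-- Multiply `A` and `B` by `16` and intersect the neighborhood with `V`. -/
def Index.next (i : Index U) {V : Set (Fin k → ℝ)} (hV : IsConicNhd V U.carrier) : Index U where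
  A := 16 * i.A
  B := 16 * i.B
  W := i.W ∩ V
  A_pos := mul_pos (by norm_num) i.A_pos
  B_pos := mul_pos (by norm_num) i.B_pos
  isConicNhd := i.isConicNhd.inter hV

/-- 16 = 2⁴: two Hilbert–Schmidt inclusions cost two doublings each. -/
theorem Index.doubles_next (i : Index U) {V : Set (Fin k → ℝ)} (hV : IsConicNhd V U.carrier) :
    i.double.double.double.Doubles (i.next hV) :=
  ⟨by simp only [double, next]; linarith, by simp only [double, next]; linarith,
    inter_subset_left.trans subset_closure⟩

/-- The indices `(16 ^ n, 16 ^ n, W 0 ∩ ⋯ ∩ W n)`. -/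
def indexSeq {W : ℕ → Set (Fin k → ℝ)} (hW : ∀ n, IsConicNhd (W n) U.carrier) : ℕ → Index U
  | 0 => ⟨1, 1, W 0, one_pos, one_pos, hW 0⟩
  | n + 1 => (indexSeq hW n).next (hW (n + 1))

theorem indexSeq_A {W : ℕ → Set (Fin k → ℝ)} (hW : ∀ n, IsConicNhd (W n) U.carrier) (n : ℕ) :
    (indexSeq hW n).A = 16 ^ n := by
  induction n with
  | zero => rfl
  | succ n ih =>
    change 16 * (indexSeq hW n).A = _
    rw [ih]
    ring

theorem indexSeq_B {W : ℕ → Set (Fin k → ℝ)} (hW : ∀ n, IsConicNhd (W n) U.carrier) (n : ℕ) :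
    (indexSeq hW n).B = 16 ^ n := by
  induction n with
  | zero => rfl
  | succ n ih =>
    change 16 * (indexSeq hW n).B = _
    rw [ih]
    ring

theorem indexSeq_subset {W : ℕ → Set (Fin k → ℝ)} (hW : ∀ n, IsConicNhd (W n) U.carrier)
    {m n : ℕ} (h : m ≤ n) : (indexSeq hW n).W ⊆ W m := by
  induction n, h using Nat.le_induction with
  | base =>
    cases m with
    | zero => exact Subset.rfl
    | succ m => exact inter_subset_right
  | succ n _ ih => exact inter_subset_left.trans ih

theorem NonemptyCone.CountablyGenerated.exists_cofinal (hU : U.CountablyGenerated) :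
    ∃ s : ℕ → Index U, (∀ n, (s n).double.double.double.Doubles (s (n + 1))) ∧
      ∀ i : Index U, ∃ n, i.Doubles (s n) := by
  obtain ⟨W, hW, hWV⟩ := hU
  refine ⟨indexSeq hW, fun n => (indexSeq hW n).doubles_next (hW (n + 1)), fun i => ?_⟩
  obtain ⟨m, hm⟩ := hWV i.W i.isConicNhd
  have hpow : Tendsto (fun n : ℕ => (16 : ℝ) ^ n) atTop atTop :=
    tendsto_pow_atTop_atTop_of_one_lt (by norm_num)
  obtain ⟨n, h1, h2, h3⟩ := ((hpow.eventually_ge_atTop (2 * i.A)).and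
    ((hpow.eventually_ge_atTop (2 * i.B)).and (eventually_ge_atTop m))).exists
  exact ⟨n, by rwa [indexSeq_A], by rwa [indexSeq_B], (indexSeq_subset hW h3).trans hm⟩

theorem NonemptyCone.countablyGenerated_of_hasOpenProjection
    (hU : HasOpenProjection U.carrier) : U.CountablyGenerated :=
  ⟨fun _ => U.carrier, fun _ => ⟨U.isCone, hU, Subset.rfl⟩,
    fun _ hV => ⟨0, hV.subset.trans subset_closure⟩⟩

/-- The union of `{0}` and the set of points whose distance from `U` is less than `‖x‖ / (n + 1)`. -/
def angularNhd (U : Set (Fin k → ℝ)) (n : ℕ) : Set (Fin k → ℝ) :=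
  {x | ∃ u ∈ U, dist x u * (n + 1) < ‖x‖} ∪ {0}

theorem NonemptyCone.isConicNhd_angularNhd (U : NonemptyCone k) (n : ℕ) :
    IsConicNhd (angularNhd U.carrier n) U.carrier where
  isCone := by
    rintro x (⟨u, hu, hxu⟩ | hx) t ht
    · refine Or.inl ⟨t • u, U.isCone u hu t ht, ?_⟩
      rw [dist_smul₀, norm_smul, mul_assoc, Real.norm_of_nonneg ht.le]
      gcongr
    · rw [mem_singleton_iff.1 hx, smul_zero]
      exact Or.inr rfl
  isOpen := by
    have h1 : angularNhd U.carrier n \ {0} =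
        ⋃ u ∈ U.carrier, {x | dist x u * (n + 1) < ‖x‖} \ {0} := by
      ext x
      simp only [angularNhd, Set.mem_sdiff, mem_union, mem_iUnion, mem_ofPred_eq, mem_singleton_iff]
      grind
    unfold HasOpenProjection
    rw [h1]
    refine isOpen_biUnion fun u _ => (isOpen_lt ?_ ?_).sdiff isClosed_singleton <;> fun_prop
  subset x hx := by
    by_cases h0 : x = 0
    · exact Or.inr h0
    · exact Or.inl ⟨x, hx, by simpa using h0⟩

theorem NonemptyCone.zero_mem_of_isClosed {U : NonemptyCone k} (hU : IsClosed U.carrier) :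
    (0 : Fin k → ℝ) ∈ U.carrier := by
  obtain ⟨x, hx⟩ := U.nonempty
  have h1 : Tendsto (fun n : ℕ => (1 / ((n : ℝ) + 1)) • x) atTop (𝓝 ((0 : ℝ) • x)) :=
    tendsto_one_div_add_atTop_nhds_zero_nat.smul_const x
  rw [zero_smul] at h1
  exact hU.mem_of_tendsto h1 (Eventually.of_forall fun n => U.isCone x hx _ (by positivity))

/-- Otherwise, after normalization, there are unit vectors outside `V` at distance below 1/(n + 1)
from `U`. A subsequence converges to a unit vector `a`, which lies in the closed set `U`; but V ∖
{0} is open and contains `a`, hence some of these vectors. -/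
theorem NonemptyCone.countablyGenerated_of_isClosed {U : NonemptyCone k}
    (hU : IsClosed U.carrier) : U.CountablyGenerated := by
  refine ⟨angularNhd U.carrier, U.isConicNhd_angularNhd, fun V hV => ?_⟩
  by_contra! hcon
  have hpt : ∀ n : ℕ, ∃ x u : Fin k → ℝ, ‖x‖ = 1 ∧ x ∉ V ∧ u ∈ U.carrier ∧
      dist x u < 1 / ((n : ℝ) + 1) := by
    intro n
    obtain ⟨x, hx, hxV⟩ := not_subset.1 (hcon n)
    have hxV : x ∉ V := fun h => hxV (subset_closure h)
    rcases hx with ⟨u, hu, hxu⟩ | hx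
    · have hx0 : 0 < ‖x‖ := lt_of_le_of_lt (by positivity) hxu
      refine ⟨‖x‖⁻¹ • x, ‖x‖⁻¹ • u, ?_, fun h => hxV ?_, U.isCone u hu _ (by positivity), ?_⟩
      · rw [norm_smul, norm_inv, norm_norm, inv_mul_cancel₀ hx0.ne']
      · have := hV.isCone _ h ‖x‖ hx0
        rwa [smul_inv_smul₀ hx0.ne'] at this
      · rw [dist_smul₀, norm_inv, norm_norm, inv_mul_lt_iff₀ hx0, mul_one_div,
          lt_div_iff₀ (by positivity)]
        exact hxu
    -- The adjoined point 0 causes no trouble: a nonempty closed cone contains 0, hence so does `V`.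
    · rw [mem_singleton_iff.1 hx] at hxV
      exact absurd (hV.subset (zero_mem_of_isClosed hU)) hxV
  choose x u hx hxV hu hxu using hpt
  obtain ⟨a, ha, ns, hns, hlim⟩ := (isCompact_sphere (0 : Fin k → ℝ) 1).tendsto_subseq
    fun n => mem_sphere_zero_iff_norm.2 (hx n)
  have ha0 : a ≠ 0 := by
    rintro rfl
    simp at ha
  have hdist : Tendsto (fun n => dist (x (ns n)) (u (ns n))) atTop (𝓝 0) :=
    squeeze_zero (fun _ => dist_nonneg) (fun n => (hxu (ns n)).le)
      (tendsto_one_div_add_atTop_nhds_zero_nat.comp hns.tendsto_atTop)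
  have hua : Tendsto (fun n => u (ns n)) atTop (𝓝 a) := (tendsto_iff_of_dist hdist).1 hlim
  have haV : a ∈ V \ {0} :=
    ⟨hV.subset (hU.mem_of_tendsto hua (Eventually.of_forall fun n => hu _)), ha0⟩
  obtain ⟨n, hn⟩ := (hlim.eventually (hV.isOpen.mem_nhds haV)).exists
  exact hxV _ hn.1

end

end ConeSpaces

end

theorem lemma4 {k : ℕ} (w : ConeSpaces.WeightPair) (U : ConeSpaces.NonemptyCone k) :
    -- the two unions are the same set of functions
    (ConeSpaces.supUnion w U : Set ((Fin k → ℂ) → ℂ)) = ConeSpaces.hilbertUnion w U ∧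
    -- and the identity map is an isomorphism of topological vector spaces
    (∃ e : ConeSpaces.SupSpace w U ≃L[ℂ] ConeSpaces.HilbertSpaceUnion w U,
      ∀ f, (e f).1 = f.1) ∧
    -- nuclearity and the DFS property
    (U.CountablyGenerated →
      ConeSpaces.IsNuclearSpace (ConeSpaces.SupSpace w U) ∧
      ConeSpaces.IsDFSSpace (ConeSpaces.SupSpace w U)) ∧
    -- closed cones and cones with open projection are covered
    (IsClosed U.carrier ∨ ConeSpaces.HasOpenProjection U.carrier → U.CountablyGenerated) := by
  refine ⟨congrArg _ (ConeSpaces.supUnion_eq_hilbertUnion w U),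
    ⟨ConeSpaces.supEquivHilbert w U, fun _ => rfl⟩, fun hU => ?_, fun h => h.elim
      ConeSpaces.NonemptyCone.countablyGenerated_of_isClosed
      ConeSpaces.NonemptyCone.countablyGenerated_of_hasOpenProjection⟩
  obtain ⟨s, hs, hs'⟩ := hU.exists_cofinal
  exact ⟨ConeSpaces.isNuclearSpace_of_cofinal w hs hs', ConeSpaces.isDFSSpace_of_cofinal w hs hs'⟩
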